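/- **Basic notions.** A *forest* is a poset whose principal ideals are all finite and linearly ordered; $a\rightarrowtriangle b$ means that $a<b$ with nothing strictly in between. An *arena* $A$ is a countable forest with a polarity function $\mathrm{pol}_A:|A|\to\{-,+\}$ such that $a\rightarrowtriangle_A b$ implies $\mathrm{pol}_A(a)\ne\mathrm{pol}_A(b)$; it is *negative* if its minimal events are negative. $A\vdash B$ is the disjoint union of $A$ with polarities reversed and of $B$. A *configuration* $x$ of $A$ is a finite forest with a display map $\partial_x:|x|\to|A|$ such that $a$ is minimal in $x$ iff $\partial_x(a)$ is minimal in $A$, and $a\rightarrowtriangle_x b$ implies $\partial_x(a)\rightarrowtriangle_A\partial_x(b)$. A *symmetry* $x\cong_A y$ is an order-isomorphism commuting with the display maps; *positions* are symmetry classes of configurations, and $\mathrm{Sym}(\mathsf x)$ is the group of endosymmetries of a representative of $\mathsf x$. An *augmentation* $q$ on $A$ is a configuration $\bar q=(|q|,\le_{\bar q},\partial_q)$ of $A$, called its desequentialization, with a second forest order $\le_q$ on $|q|$ such that (with $\mathrm{pol}(a)=\mathrm{pol}_A(\partial_q(a))$): $a\le_{\bar q}b$ implies $a\le_q b$; if $a\rightarrowtriangle_q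 b$ and ($\mathrm{pol}(a)=+$ or $\mathrm{pol}(b)=-$) then $a\rightarrowtriangle_{\bar q}b$; if $a^-\rightarrowtriangle_q b^+$ and $a^-\rightarrowtriangle_q c^+$ then $b=c$; $\le_q$-maximal events are positive; $\le_q$-minimal events are negative. *Isogmentations* are isomorphism classes of augmentations; $\mathsf{Isog}(A)$ is their set. A representative of each isogmentation and of each position is fixed. A *strategy* on $A$ is a function $\mathsf{Isog}(A)\to[0,\infty]$. **Composition.** Let $A,B,C$ be negative arenas, $q$ an augmentation on $A\vdash B$, $p$ one on $B\vdash C$. Write $x^q_A,x^q_B$ for the configurations obtained by restricting $\bar q$ to the events displayed to $A$, resp. $B$, and likewise $x^p_B,x^p_C$. For a symmetry $\varphi:x^q_B\cong_B x^p_B$, the *interaction* of $q$ and $p$ via $\varphi$ is $|q|+|p|$ with the reflexive transitive closure of the relation generated by $<_q$, $<_p$, the links $m\to\varphi(m)$ for $m\in x^q_B$ positive in $q$, and the links $m\to\varphi^{-1}(m)$ for $m\in x^p_B$ positive in $p$. The structure $p\odot_\varphi q$ has as causal order the restriction of the interaction to $x^q_A+x^p_C$, as desequentialization $x^q_A\vdash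 x^p_C$ and the inherited display map. For strategies $\sigma$ on $A\vdash B$ and $\tau$ on $B\vdash C$, $(\tau\odot\sigma)(\mathsf r)$ is the sum of $\sigma(\mathsf q)\,\tau(\mathsf p)$ over all triples $(\mathsf q,\mathsf p,\varphi)$ with $\mathsf q\in\mathsf{Isog}(A\vdash B)$, $\mathsf p\in\mathsf{Isog}(B\vdash C)$ and $\varphi:x^{q}_B\cong_B x^{p}_B$ (where $q,p$ are the representatives of $\mathsf q,\mathsf p$) such that $p\odot_\varphi q$ belongs to the class $\mathsf r$. **Identities.** For a configuration $x$ of $A$, the *copycat* $c\!c_x$ has desequentialization $x\vdash x$, and its causal order is the reflexive transitive closure of the order of $x\vdash x$ together with $(1,m)\le(2,n)$ if $m\le_x n$ and $m$ is positive in $A$, and $(2,m)\le(1,n)$ if $m\le_x n$ and $m$ is negative in $A$. The strategy $\mathrm{id}_A$ on $A\vdash A$ is $\sum_{\mathsf x}\frac1{|\mathrm{Sym}(\mathsf x)|}\cdot\mathsf{c\!c}_{\mathsf x}$, the sum being over all positions $\mathsf x$ of $A$, with $\mathsf{c\!c}_{\mathsf x}$ the class of $c\!c_x$ for $x$ the representative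 of $\mathsf x$. **Theorem.** These operations are well defined and form a category: 1. for every negative arena $A$ and configuration $x$ of $A$, $c\!c_x$ is an augmentation on $A\vdash A$; 2. for all $A,B,C,q,p,\varphi$ as above, $p\odot_\varphi q$ is an augmentation on $A\vdash C$; 3. if $q\cong q'$ and $p\cong p'$, there is a bijection $\chi$ from the symmetries $x^q_B\cong_B x^p_B$ to the symmetries $x^{q'}_B\cong_B x^{p'}_B$ such that $p\odot_\varphi q\cong p'\odot_{\chi(\varphi)}q'$ for all $\varphi$; 4. negative arenas, with strategies on $A\vdash B$ as morphisms from $A$ to $B$, composition $\odot$ and identities $\mathrm{id}_A$, form a category $\mathsf{Strat}$. -/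

import Mathlib

namespace ResourceGames

/-! ### Forests -/

/-- A forest: a partial order whose principal ideals are finite and linearly ordered. -/
structure IsForest {α : Type} (r : α → α → Prop) : Prop where
  refl : ∀ a, r a a
  antisymm : ∀ a b, r a b → r b a → a = b
  trans : ∀ a b c, r a b → r b c → r a c
  finite_below : ∀ a, {b | r b a}.Finite
  linear_below : ∀ a b c, r b a → r c a → r b c ∨ r c b

/-- `a` is immediately below `b`. -/
def Imm {α : Type} (r : α → α → Prop) (a b : α) : Prop :=
  r a b ∧ a ≠ b ∧ ∀ c, r a c → r c b → c = a ∨ c = b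

/-- `a` is a minimal element. -/
def IsMinimal {α : Type} (r : α → α → Prop) (a : α) : Prop := ∀ b, r b a → b = a

/-- `a` is a maximal element. -/
def IsMaximal {α : Type} (r : α → α → Prop) (a : α) : Prop := ∀ b, r a b → b = a

theorem IsForest.sum {α β : Type} {r : α → α → Prop} {s : β → β → Prop}
    (hr : IsForest r) (hs : IsForest s) : IsForest (Sum.LiftRel r s) where
  refl := by rintro (a | a) <;> simp [hr.refl, hs.refl]
  antisymm := by
    rintro (a | a) (b | b) <;> simp
    · exact hr.antisymm a b
    · exact hs.antisymm a b
  trans := by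
    rintro (a | a) (b | b) (c | c) <;> simp
    · exact hr.trans a b c
    · exact hs.trans a b c
  finite_below := by
    rintro (a | a)
    · refine ((hr.finite_below a).image Sum.inl).subset ?_
      rintro (b | b) <;> simp
    · refine ((hs.finite_below a).image Sum.inr).subset ?_
      rintro (b | b) <;> simp
  linear_below := by
    rintro (a | a) (b | b) (c | c) <;> simp
    · exact hr.linear_below a b c
    · exact hs.linear_below a b c

/-! ### Arenas -/

inductive Polarity : Type
  | neg : Polarity
  | pos : Polarity

/-- The opposite polarity. -/
def Polarity.flip : Polarity → Polarity
  | .neg => .pos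
  | .pos => .neg

theorem Polarity.flip_injective : Function.Injective Polarity.flip := by
  intro a b h
  cases a <;> cases b <;> first | rfl | cases h

structure Arena : Type 1 where
  Ev : Type
  countable : Countable Ev
  le : Ev → Ev → Prop
  forest : IsForest le
  pol : Ev → Polarity
  alternating : ∀ a b, Imm le a b → pol a ≠ pol b

structure NegArena : Type 1 extends Arena where
  negative : ∀ a, IsMinimal le a → pol a = Polarity.neg

/-- The arena with all polarities reversed. -/
abbrev Arena.dual (A : Arena) : Arena where
  Ev := A.Ev
  countable := A.countable
  le := A.le
  forest := A.forest
  pol a := (A.pol a).flip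
  alternating a b h e := A.alternating a b h (Polarity.flip_injective e)

/-- The tensor: disjoint union of arenas. -/
abbrev Arena.tensor (A B : Arena) : Arena where
  Ev := A.Ev ⊕ B.Ev
  countable := by
    have := A.countable
    have := B.countable
    infer_instance
  le := Sum.LiftRel A.le B.le
  forest := A.forest.sum B.forest
  pol := Sum.elim A.pol B.pol
  alternating := by
    rintro (a | a) (b | b) ⟨h1, h2, h3⟩
    · refine A.alternating a b ⟨by simpa using h1, by simpa using h2, fun c hac hcb => ?_⟩
      simpa using h3 (Sum.inl c) (by simpa using hac) (by simpa using hcb)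
    · simp at h1
    · simp at h1
    · refine B.alternating a b ⟨by simpa using h1, by simpa using h2, fun c hac hcb => ?_⟩
      simpa using h3 (Sum.inr c) (by simpa using hac) (by simpa using hcb)

/-- The hom-game `A ⊢ B`. -/
abbrev Arena.hom (A B : Arena) : Arena := A.dual.tensor B

/-! ### Configurations, symmetries, positions -/

/-- `(X, le, disp)` is a configuration of `A`. -/
structure IsConf (A : Arena) {X : Type} (le : X → X → Prop) (disp : X → A.Ev) : Prop where
  finite : Finite X
  forest : IsForest le
  minimal_iff : ∀ a, IsMinimal le a ↔ IsMinimal A.le (disp a)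
  imm : ∀ a b, Imm le a b → Imm A.le (disp a) (disp b)

structure Conf (A : Arena) : Type 1 where
  Ev : Type
  le : Ev → Ev → Prop
  disp : Ev → A.Ev
  isConf : IsConf A le disp

/-- Symmetries `x ≅_A y`: order-isomorphisms commuting with the display maps. -/
def Conf.Symmetry {A : Arena} (x y : Conf A) : Type :=
  {φ : x.le ≃r y.le // ∀ a, y.disp (φ a) = x.disp a}

instance Conf.setoid (A : Arena) : Setoid (Conf A) where
  r x y := Nonempty (x.Symmetry y)
  iseqv :=
    { refl := fun x => ⟨⟨RelIso.refl _, fun _ => rfl⟩⟩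
      symm := fun {x y} ⟨φ⟩ => ⟨⟨φ.1.symm, fun a => by
        rw [← φ.2 (φ.1.symm a), RelIso.apply_symm_apply]⟩⟩
      trans := fun {x y z} ⟨φ⟩ ⟨ψ⟩ => ⟨⟨φ.1.trans ψ.1, fun a =>
        (ψ.2 (φ.1 a)).trans (φ.2 a)⟩⟩ }

/-- Positions: symmetry classes of configurations. -/
def Position (A : Arena) : Type 1 := Quotient (Conf.setoid A)

/-- The display map of a configuration is monotone. -/
theorem IsConf.le_of_le {A : Arena} {X : Type} {le : X → X → Prop} {disp : X → A.Ev}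
    (h : IsConf A le disp) (a b : X) (hab : le a b) : A.le (disp a) (disp b) := by
  have key : ∀ (n : ℕ) (a b : X), le a b → {c | le c b}.ncard ≤ n →
      A.le (disp a) (disp b) := by
    have := h.finite
    intro n
    induction n with
    | zero =>
      intro a b hab hn
      have h0 : {c | le c b}.ncard = 0 := by omega
      rw [Set.ncard_eq_zero] at h0
      exact absurd (show a ∈ {c | le c b} from hab) (by simp [h0])
    | succ n ih =>
      intro a b hab hn
      by_cases e : a = b
      · rw [e]
        exact A.forest.refl _
      by_cases hi : Imm le a b
      · exact (h.imm a b hi).1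
      have hc : ∃ c, le a c ∧ le c b ∧ c ≠ a ∧ c ≠ b := by
        by_contra hne
        refine hi ⟨hab, e, fun c h1 h2 => ?_⟩
        by_contra h3
        rw [not_or] at h3
        exact hne ⟨c, h1, h2, h3.1, h3.2⟩
      have hc' : ∃ c, le a c ∧ Imm le c b := by
        have hfin : {c | le a c ∧ le c b ∧ c ≠ b}.Finite := Set.toFinite _
        have hne : {c | le a c ∧ le c b ∧ c ≠ b}.Nonempty := ⟨a, h.forest.refl a, hab, e⟩
        obtain ⟨m, ⟨hm1, hm2, hm3⟩, hm⟩ :=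
          Set.exists_max_image _ (fun c => {d | le d c}.ncard) hfin hne
        refine ⟨m, hm1, hm2, hm3, fun c h1 h2 => ?_⟩
        by_contra h3
        rw [not_or] at h3
        have := hm c ⟨h.forest.trans _ _ _ hm1 h1, h2, h3.2⟩
        have hlt : {d | le d m}.ncard < {d | le d c}.ncard := by
          refine Set.ncard_lt_ncard ⟨fun d hd => h.forest.trans _ _ _ hd h1, fun hs => ?_⟩
          exact h3.1 (h.forest.antisymm _ _ (hs (h.forest.refl c)) h1)
        omega
      obtain ⟨c, hac, hcb⟩ := hc'
      refine A.forest.trans _ _ _ (ih a c hac ?_) (h.imm c b hcb).1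
      have hlt : {d | le d c}.ncard < {d | le d b}.ncard := by
        refine Set.ncard_lt_ncard ⟨fun d hd => h.forest.trans _ _ _ hd hcb.1, fun hs => ?_⟩
        exact hcb.2.1 (h.forest.antisymm _ _ hcb.1 (hs (h.forest.refl b)))
      omega
  exact key _ a b hab le_rfl

theorem IsForest.subtype {α : Type} {r : α → α → Prop} (h : IsForest r) (P : α → Prop) :
    IsForest (fun a b : {a // P a} => r a.1 b.1) where
  refl _ := h.refl _
  antisymm _ _ h1 h2 := Subtype.ext (h.antisymm _ _ h1 h2)
  trans _ _ _ h1 h2 := h.trans _ _ _ h1 h2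
  finite_below a :=
    Set.Finite.preimage (f := Subtype.val) Subtype.val_injective.injOn (h.finite_below a.1)
  linear_below _ _ _ h1 h2 := h.linear_below _ _ _ h1 h2

/-- Restriction of a configuration of `D` to the events displayed in a downwards closed part of `D`
isomorphic to `A`. -/
theorem IsConf.restrict {A D : Arena} {X : Type} {le : X → X → Prop} {disp : X → D.Ev}
    (h : IsConf D le disp) (f : A.Ev → D.Ev) (hf : Function.Injective f)
    (hle : ∀ a b, D.le (f a) (f b) ↔ A.le a b)
    (hdown : ∀ a d, D.le d (f a) → ∃ b, f b = d)
    (P : X → Prop) (hP : ∀ m a, disp m = f a → P m)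
    (d : {m : X // P m} → A.Ev) (hd : ∀ m, f (d m) = disp m.1) :
    IsConf A (fun m n : {m : X // P m} => le m.1 n.1) d := by
  have down : ∀ m n, le m n → P n → P m := by
    intro m n hmn hn
    have h1 := h.le_of_le m n hmn
    rw [← hd ⟨n, hn⟩] at h1
    obtain ⟨b, hb⟩ := hdown _ _ h1
    exact hP m b hb.symm
  refine ⟨?_, h.forest.subtype _, ?_, ?_⟩
  · have := h.finite
    exact Subtype.finite
  · intro m
    have h1 := h.minimal_iff m.1
    rw [← hd m] at h1
    have h2 : IsMinimal D.le (f (d m)) ↔ IsMinimal A.le (d m) := by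
      constructor
      · intro k b hb
        exact hf (k (f b) ((hle _ _).2 hb))
      · intro k e he
        obtain ⟨b, rfl⟩ := hdown _ _ he
        exact congrArg f (k b ((hle _ _).1 he))
    rw [← h2, ← h1]
    constructor
    · intro k n hn
      exact congrArg Subtype.val (k ⟨n, down n m.1 hn m.2⟩ hn)
    · intro k n hn
      exact Subtype.ext (k n.1 hn)
  · rintro m n ⟨h1, h2, h3⟩
    have h4 := h.imm m.1 n.1 ⟨h1, fun e => h2 (Subtype.ext e), fun c hmc hcn =>
      (h3 ⟨c, down c n.1 hcn n.2⟩ hmc hcn).imp (congrArg Subtype.val) (congrArg Subtype.val)⟩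
    rw [← hd m, ← hd n] at h4
    obtain ⟨k1, k2, k3⟩ := h4
    refine ⟨(hle _ _).1 k1, fun e => k2 (congrArg f e), fun c hac hcb => ?_⟩
    exact (k3 (f c) ((hle _ _).2 hac) ((hle _ _).2 hcb)).imp (fun e => hf e) (fun e => hf e)

/-- The restriction `x_A` of a configuration `x` of `A ⊢ B` to the events displayed to `A`. -/
def Conf.left {A B : Arena} (x : Conf (A.hom B)) : Conf A where
  Ev := {m : x.Ev // Sum.isLeft (x.disp m) = true}
  le m n := x.le m.1 n.1
  disp m := Sum.getLeft (x.disp m.1) m.2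
  isConf := IsConf.restrict (A := A) (D := A.hom B) x.isConf Sum.inl Sum.inl_injective (fun _ _ => Sum.liftRel_inl_inl)
    (by rintro a (d | d) h
        · exact ⟨d, rfl⟩
        · cases h)
    (fun m => Sum.isLeft (x.disp m) = true)
    (fun m a h => by rw [h]; rfl) _ (fun m => Sum.inl_getLeft _ _)

/-- The restriction `x_B` of a configuration `x` of `A ⊢ B` to the events displayed to `B`. -/
def Conf.right {A B : Arena} (x : Conf (A.hom B)) : Conf B where
  Ev := {m : x.Ev // Sum.isRight (x.disp m) = true}
  le m n := x.le m.1 n.1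
  disp m := Sum.getRight (x.disp m.1) m.2
  isConf := IsConf.restrict (A := B) (D := A.hom B) x.isConf Sum.inr Sum.inr_injective (fun _ _ => Sum.liftRel_inr_inr)
    (by rintro a (d | d) h
        · cases h
        · exact ⟨d, rfl⟩)
    (fun m => Sum.isRight (x.disp m) = true)
    (fun m a h => by rw [h]; rfl) _ (fun m => Sum.inr_getRight _ _)

/-! ### Augmentations and isogmentations -/

/-- The data of an augmentation, without its axioms: a set of events with a static order `sle`
(that of the desequentialization), a causal order `le` and a display map. -/
structure PreAug (A : Arena) : Type 1 where
  Ev : Type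
  sle : Ev → Ev → Prop
  le : Ev → Ev → Prop
  disp : Ev → A.Ev

/-- The polarity of an event. -/
def PreAug.pol {A : Arena} (q : PreAug A) (m : q.Ev) : Polarity := A.pol (q.disp m)

/-- The axioms of augmentations. -/
structure PreAug.IsAug {A : Arena} (q : PreAug A) : Prop where
  conf : IsConf A q.sle q.disp
  forest : IsForest q.le
  ruleAbiding : ∀ a b, q.sle a b → q.le a b
  courteous : ∀ a b, Imm q.le a b → (q.pol a = Polarity.pos ∨ q.pol b = Polarity.neg) →
    Imm q.sle a b
  deterministic : ∀ a b c, q.pol a = Polarity.neg → q.pol b = Polarity.pos →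
    q.pol c = Polarity.pos → Imm q.le a b → Imm q.le a c → b = c
  covered : ∀ a, IsMaximal q.le a → q.pol a = Polarity.pos
  negative : ∀ a, IsMinimal q.le a → q.pol a = Polarity.neg

structure Aug (A : Arena) : Type 1 extends PreAug A where
  isAug : toPreAug.IsAug

/-- The desequentialization of an augmentation. -/
def Aug.deseq {A : Arena} (q : Aug A) : Conf A where
  Ev := q.Ev
  le := q.sle
  disp := q.disp
  isConf := q.isAug.conf

/-- Isomorphism: there is a bijection preserving and reflecting all the structure. -/
def PreAug.Isomorphic {A : Arena} (q p : PreAug A) : Prop :=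
  ∃ e : q.Ev ≃ p.Ev, (∀ a b, p.sle (e a) (e b) ↔ q.sle a b) ∧
    (∀ a b, p.le (e a) (e b) ↔ q.le a b) ∧ ∀ a, p.disp (e a) = q.disp a

instance Aug.setoid (A : Arena) : Setoid (Aug A) where
  r q p := q.toPreAug.Isomorphic p.toPreAug
  iseqv :=
    { refl := fun q => ⟨Equiv.refl _, fun _ _ => Iff.rfl, fun _ _ => Iff.rfl, fun _ => rfl⟩
      symm := fun {q p} ⟨e, h1, h2, h3⟩ => ⟨e.symm,
        fun a b => by rw [← h1, e.apply_symm_apply, e.apply_symm_apply],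
        fun a b => by rw [← h2, e.apply_symm_apply, e.apply_symm_apply],
        fun a => by rw [← h3, e.apply_symm_apply]⟩
      trans := fun {q p r} ⟨e, h1, h2, h3⟩ ⟨f, k1, k2, k3⟩ => ⟨e.trans f,
        fun a b => (k1 _ _).trans (h1 _ _), fun a b => (k2 _ _).trans (h2 _ _),
        fun a => (k3 _).trans (h3 _)⟩ }

/-- Isogmentations: isomorphism classes of augmentations. -/
def Isog (A : Arena) : Type 1 := Quotient (Aug.setoid A)

/-- The chosen representative of an isogmentation. -/
noncomputable def Isog.rep {A : Arena} (q : Isog A) : Aug A := Quotient.out q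

/-- The chosen representative of a position. -/
noncomputable def Position.rep {A : Arena} (x : Position A) : Conf A := Quotient.out x

/-! ### Interaction and composition of augmentations -/

section Composition

variable {A B C : Arena} (q : Aug (A.hom B)) (p : Aug (B.hom C))
  (φ : q.deseq.right.Symmetry p.deseq.left)

/-- The relation generating the causal order of the interaction of `q` and `p` via `φ`. -/
inductive InterStep : q.Ev ⊕ p.Ev → q.Ev ⊕ p.Ev → Prop
  | inl (m m' : q.Ev) : q.le m m' → m ≠ m' → InterStep (Sum.inl m) (Sum.inl m')
  | inr (m m' : p.Ev) : p.le m m' → m ≠ m' → InterStep (Sum.inr m) (Sum.inr m')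
  | sync (m : q.deseq.right.Ev) : q.pol m.1 = Polarity.pos →
      InterStep (Sum.inl m.1) (Sum.inr (φ.1 m).1)
  | syncSymm (m : p.deseq.left.Ev) : p.pol m.1 = Polarity.pos →
      InterStep (Sum.inr m.1) (Sum.inl (φ.1.symm m).1)

/-- The causal order of the interaction. -/
def interLe : q.Ev ⊕ p.Ev → q.Ev ⊕ p.Ev → Prop := Relation.ReflTransGen (InterStep q p φ)

/-- Inclusion of the visible events `x_A + x_C` into the events of the interaction. -/
def visible : q.deseq.left.Ev ⊕ p.deseq.right.Ev → q.Ev ⊕ p.Ev :=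
  Sum.map (fun m => m.1) (fun m => m.1)

/-- The composition of `q` and `p` via `φ`: the interaction restricted to the visible events, with
desequentialization `x_A ⊢ x_C`. -/
def PreAug.comp : PreAug (A.hom C) where
  Ev := q.deseq.left.Ev ⊕ p.deseq.right.Ev
  sle := Sum.LiftRel q.deseq.left.le p.deseq.right.le
  le m n := interLe q p φ (visible q p m) (visible q p n)
  disp := Sum.map q.deseq.left.disp p.deseq.right.disp

end Composition

/-! ### Copycat -/

/-- The relation generating the causal order of the copycat augmentation on `x`. -/
inductive CopycatStep {A : Arena} (x : Conf A) : x.Ev ⊕ x.Ev → x.Ev ⊕ x.Ev → Prop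
  | inl (m n : x.Ev) : x.le m n → CopycatStep x (Sum.inl m) (Sum.inl n)
  | inr (m n : x.Ev) : x.le m n → CopycatStep x (Sum.inr m) (Sum.inr n)
  | pos (m n : x.Ev) : x.le m n → A.pol (x.disp m) = Polarity.pos →
      CopycatStep x (Sum.inl m) (Sum.inr n)
  | neg (m n : x.Ev) : x.le m n → A.pol (x.disp m) = Polarity.neg →
      CopycatStep x (Sum.inr m) (Sum.inl n)

/-- The copycat augmentation on `x`, with desequentialization `x ⊢ x`. -/
def PreAug.copycat {A : Arena} (x : Conf A) : PreAug (A.hom A) where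
  Ev := x.Ev ⊕ x.Ev
  sle := Sum.LiftRel x.le x.le
  le := Relation.ReflTransGen (CopycatStep x)
  disp := Sum.map x.disp x.disp

/-! ### Strategies -/

/-- Strategies on `A`: weighted sums of isogmentations. -/
def Strategy (A : Arena) : Type 1 := Isog A → ENNReal

open Classical in
/-- Composition of strategies: the coefficient of `r` is the sum of `σ q * τ p` over all triples
`(q, p, φ)` such that `r` is the isomorphism class of the composition of `q` and `p` via `φ`. -/
noncomputable def Strategy.comp {A B C : Arena} (σ : Strategy (A.hom B))
    (τ : Strategy (B.hom C)) : Strategy (A.hom C) := fun r =>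
  ∑' (q : Isog (A.hom B)) (p : Isog (B.hom C))
    (φ : q.rep.deseq.right.Symmetry p.rep.deseq.left),
    if (PreAug.comp q.rep p.rep φ).Isomorphic r.rep.toPreAug then σ q * τ p else 0

open Classical in
/-- The identity strategy: the sum over all positions `x` of the copycat isogmentation on `x`, with
coefficient the inverse of the number of endosymmetries of `x`. -/
noncomputable def Strategy.id (A : Arena) : Strategy (A.hom A) := fun r =>
  ∑' x : Position A,
    if (PreAug.copycat x.rep).Isomorphic r.rep.toPreAug then
      ((Nat.card (x.rep.Symmetry x.rep) : ENNReal))⁻¹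
    else 0

/-- The data of `Strat`: objects are negative arenas, morphisms from `A` to `B` are strategies
on `A ⊢ B`. -/
noncomputable abbrev stratStruct : CategoryTheory.CategoryStruct.{1, 1} NegArena where
  Hom A B := Strategy (A.toArena.hom B.toArena)
  id A := Strategy.id A.toArena
  comp σ τ := Strategy.comp σ τ

end ResourceGames

namespace ResourceGames

/-! The crux is that synchronising two augmentations never deadlocks. Both are regarded as one
augmentation on the disjoint union of their events (`Interaction`), whose hidden events, those
displayed to `B`, are paired by an involution `dual` that reverses polarity. Call the immediate
static predecessor of an event its justifier. By courtesy the immediate predecessor of a negative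
event is its justifier, so the causes of a hidden negative event are also causes of its positive
dual (`ile_dual_of_le`). Starting from a positive event on or above a loop, this yields another one,
on the other side, whose justifier lies strictly above that of the first (`exists_not_acc_of_pos`).
Finiteness forbids repeating this forever. Since `B` is negative, the hidden positive events of `q`
do have justifiers, so the repetition can start. Hence `step_wf`.

Once loops are excluded, the last cause of an event is explicit: its predecessor if it is positive,
its dual if it is hidden and negative, its justifier, if any, if it is visible and negative. The
interaction is therefore a forest. The remaining axioms for the visible part hold because hidden
events come in forced chains: a negative event has exactly one immediate successor, which is
positive, and a hidden positive event passes control to its dual. This gives `comp_isAug`. For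
copycat, an explicit description `CopyLe` of the causal order gives the axioms directly.

The laws are first proved for augmentations with fixed symmetries. Both bracketings of a triple
composition are restrictions of one ternary interaction (`comp_assoc`). Composing with copycat along
any symmetry returns the augmentation up to isomorphism (`comp_copycat_left`, `comp_copycat_right`),
because exchanging an event for its copy respects courtesy.

For strategies, the coefficients count symmetries (`weight`). Associativity compares two counts of
pairs of symmetries. In the unit laws, each position symmetric to the relevant restriction
contributes as many symmetries as it has endosymmetries; exactly one position does, and the factor
`1/|Sym|` normalises the total to one. All sums are in `[0,∞]`, so they may be rearranged freely. -/

theorem Polarity.eq_pos_or_neg (a : Polarity) : a = .pos ∨ a = .neg := by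
  cases a <;> simp

theorem Polarity.ne_pos_iff {a : Polarity} : a ≠ .pos ↔ a = .neg := by
  cases a <;> simp

theorem Polarity.ne_neg_iff {a : Polarity} : a ≠ .neg ↔ a = .pos := by
  cases a <;> simp

theorem Polarity.flip_eq_pos_iff {a : Polarity} : a.flip = .pos ↔ a = .neg := by
  cases a <;> simp [Polarity.flip]

theorem Polarity.flip_eq_neg_iff {a : Polarity} : a.flip = .neg ↔ a = .pos := by
  cases a <;> simp [Polarity.flip]

/-! ### Forests: immediate predecessors and successors -/

/-- The number of predecessors serves as a rank, by which extremal elements of principal ideals are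
chosen. -/
theorem IsForest.ncard_lt {α : Type} {r : α → α → Prop} (h : IsForest r) {a b : α}
    (hab : r a b) (hne : a ≠ b) : {d | r d a}.ncard < {d | r d b}.ncard := by
  refine Set.ncard_lt_ncard ⟨fun d hd => h.trans _ _ _ hd hab, fun hs => ?_⟩ (h.finite_below b)
  exact hne (h.antisymm _ _ hab (hs (h.refl b)))

theorem IsForest.exists_minimal_mem {α : Type} {r : α → α → Prop} (h : IsForest r)
    (P : α → Prop) {a : α} (ha : P a) : ∃ m, P m ∧ r m a ∧ ∀ b, r b m → P b → b = m := by
  obtain ⟨m, ⟨hm1, hm2⟩, hm⟩ := Set.exists_min_image {b | r b a ∧ P b}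
    (fun c => {d | r d c}.ncard) ((h.finite_below a).subset fun _ hb => hb.1) ⟨a, h.refl a, ha⟩
  refine ⟨m, hm2, hm1, fun b hb hPb => ?_⟩
  by_contra hne
  have h1 := hm b ⟨h.trans _ _ _ hb hm1, hPb⟩
  have h2 := h.ncard_lt hb hne
  omega

theorem IsForest.exists_imm_below {α : Type} {r : α → α → Prop} (h : IsForest r) {a b : α}
    (hab : r a b) (hne : a ≠ b) : ∃ c, r a c ∧ Imm r c b := by
  obtain ⟨m, ⟨hm1, hm2, hm3⟩, hm⟩ := Set.exists_max_image {c | r a c ∧ r c b ∧ c ≠ b}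
    (fun c => {d | r d c}.ncard) ((h.finite_below b).subset fun _ hb => hb.2.1)
    ⟨a, h.refl a, hab, hne⟩
  refine ⟨m, hm1, hm2, hm3, fun c h1 h2 => ?_⟩
  by_contra! h3
  have h4 := hm c ⟨h.trans _ _ _ hm1 h1, h2, h3.2⟩
  have h5 := h.ncard_lt h1 (Ne.symm h3.1)
  omega

theorem IsForest.exists_imm_above {α : Type} {r : α → α → Prop} (h : IsForest r) {a b : α}
    (hab : r a b) (hne : a ≠ b) : ∃ c, Imm r a c ∧ r c b := by
  obtain ⟨m, ⟨⟨hm1, hm2⟩, hm3⟩, -, hm⟩ := h.exists_minimal_mem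
    (fun c => (r a c ∧ r c b) ∧ a ≠ c) (a := b) ⟨⟨hab, h.refl b⟩, hne⟩
  refine ⟨m, ⟨hm1, hm3, fun c h1 h2 => ?_⟩, hm2⟩
  by_cases hc : a = c
  · exact Or.inl hc.symm
  · exact Or.inr (hm c h2 ⟨⟨h1, h.trans _ _ _ h2 hm2⟩, hc⟩)

/-! ### Interactions: causal order and duality -/

/-- Two augmentations synchronised along a duality between their hidden events, seen as a single
augmentation `(le, sle, pol)` on the disjoint union of their events. -/
structure Interaction (E : Type) where
  le : E → E → Prop
  sle : E → E → Prop
  pol : E → Polarity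
  hidden : E → Prop
  dual : E → E
  side : E → Bool
  finite : Finite E
  forest : IsForest le
  sle_forest : IsForest sle
  ruleAbiding : ∀ a b, sle a b → le a b
  alternating : ∀ a b, Imm sle a b → pol a ≠ pol b
  courteous : ∀ a b, Imm le a b → (pol a = .pos ∨ pol b = .neg) → Imm sle a b
  deterministic : ∀ a b c, pol a = .neg → pol b = .pos → pol c = .pos →
    Imm le a b → Imm le a c → b = c
  covered : ∀ a, IsMaximal le a → pol a = .pos
  negative : ∀ a, IsMinimal le a → pol a = .neg
  hidden_iff : ∀ a b, sle a b → (hidden a ↔ hidden b)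
  hidden_dual : ∀ a, hidden a → hidden (dual a)
  dual_dual : ∀ a, hidden a → dual (dual a) = a
  pol_dual : ∀ a, hidden a → pol (dual a) = (pol a).flip
  sle_dual : ∀ a b, hidden a → hidden b → sle a b → sle (dual a) (dual b)
  side_le : ∀ a b, le a b → side a = side b
  side_dual : ∀ a, hidden a → side (dual a) = !side a
  side_minimal : ∀ a, hidden a → pol a = .pos → IsMinimal sle a → side a = true

namespace Interaction

variable {E : Type} (I : Interaction E)

/-- A generating step of the causal order of the interaction. -/
def Step (a b : E) : Prop :=
  (I.le a b ∧ a ≠ b) ∨ (I.hidden a ∧ I.pol a = .pos ∧ b = I.dual a)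

/-- The causal order of the interaction. -/
def ile : E → E → Prop := Relation.ReflTransGen I.Step

variable {I}

theorem ile_of_le {a b : E} (h : I.le a b) : I.ile a b := by
  by_cases e : a = b
  · rw [e]
    exact .refl
  · exact .single (Or.inl ⟨h, e⟩)

theorem ile_dual {a : E} (h : I.hidden a) (hp : I.pol a = .pos) : I.ile a (I.dual a) :=
  .single (Or.inr ⟨h, hp, rfl⟩)

theorem pol_dual_of_pos {a : E} (h : I.hidden a) (hp : I.pol a = .pos) :
    I.pol (I.dual a) = .neg := by
  rw [I.pol_dual a h, hp, Polarity.flip]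

theorem pol_dual_of_neg {a : E} (h : I.hidden a) (hp : I.pol a = .neg) :
    I.pol (I.dual a) = .pos := by
  rw [I.pol_dual a h, hp, Polarity.flip]

/-- The immediate causal predecessor of a negative event is a static one by courtesy, and positive
by alternation. -/
theorem exists_justifier {a b : E} (hb : I.pol b = .neg) (hab : I.le a b) (hne : a ≠ b) :
    ∃ c, Imm I.sle c b ∧ I.le a c ∧ I.pol c = .pos := by
  obtain ⟨c, hac, hc⟩ := I.forest.exists_imm_below hab hne
  have hs := I.courteous c b hc (Or.inr hb)
  refine ⟨c, hs, hac, ?_⟩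
  have := I.alternating c b hs
  rw [hb, Polarity.ne_neg_iff] at this
  exact this

/-- A link leaving a positive event is static by courtesy, and static links alternate. -/
theorem pol_neg_of_imm_of_pos {a b : E} (h : Imm I.le a b) (hb : I.pol b = .pos) :
    I.pol a = .neg := by
  rcases (I.pol a).eq_pos_or_neg with ha | ha
  · exact absurd (ha.trans hb.symm) (I.alternating a b (I.courteous a b h (Or.inl ha)))
  · exact ha

theorem pol_pos_of_imm_of_neg {a b : E} (h : Imm I.le a b) (ha : I.pol a = .neg) :
    I.pol b = .pos := by
  rcases (I.pol b).eq_pos_or_neg with hb | hb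
  · exact hb
  · exact absurd (ha.trans hb.symm) (I.alternating a b (I.courteous a b h (Or.inr hb)))

theorem pol_neg_of_simm_of_pos {a b : E} (h : Imm I.sle a b) (hb : I.pol b = .pos) :
    I.pol a = .neg := by
  have := I.alternating a b h
  rwa [hb, Polarity.ne_pos_iff] at this

theorem imm_dual {a b : E} (ha : I.hidden a) (h : Imm I.sle a b) :
    Imm I.sle (I.dual a) (I.dual b) := by
  have hb := (I.hidden_iff a b h.1).1 ha
  refine ⟨I.sle_dual a b ha hb h.1, fun e => h.2.1 ?_, fun c h1 h2 => ?_⟩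
  · rw [← I.dual_dual a ha, e, I.dual_dual b hb]
  · have hc := (I.hidden_iff _ _ h1).1 (I.hidden_dual a ha)
    have k1 := I.sle_dual _ _ (I.hidden_dual a ha) hc h1
    have k2 := I.sle_dual _ _ hc (I.hidden_dual b hb) h2
    rw [I.dual_dual a ha] at k1
    rw [I.dual_dual b hb] at k2
    rw [← I.dual_dual c hc]
    exact (h.2.2 _ k1 k2).imp (congrArg _) (congrArg _)

/-- The causes of `b` lie below its justifier, which is hidden and positive. The justifier triggers
its own dual, and that dual statically precedes `dual b`. -/
theorem ile_dual_of_le {a b : E} (hb : I.hidden b) (hp : I.pol b = .neg) (hab : I.le a b)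
    (hne : a ≠ b) : I.ile a (I.dual b) := by
  obtain ⟨c, hc, hac, hcp⟩ := exists_justifier hp hab hne
  have hch := (I.hidden_iff c b hc.1).2 hb
  exact ((ile_of_le hac).trans (ile_dual hch hcp)).trans
    (ile_of_le (I.ruleAbiding _ _ (imm_dual hch hc).1))

/-! ### Absence of causal loops -/

theorem acc_of_ile {a b : E} (h : I.ile a b) (hb : Acc I.Step b) : Acc I.Step a := by
  induction h with
  | refl => exact hb
  | tail _ h2 ih => exact ih (hb.inv h2)

theorem exists_step_of_not_acc {x : E} (h : ¬ Acc I.Step x) : ∃ y, I.Step y x ∧ ¬ Acc I.Step y := by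
  by_contra! hne
  exact h ⟨x, hne⟩

/-- Non-accessibility stands for lying on or above a loop. It enters a hidden negative event either
from a cause in the same augmentation, which is also a cause of the dual by `ile_dual_of_le`, or
from the dual itself. -/
theorem not_acc_dual {x : E} (h : ¬ Acc I.Step x) (hx : I.hidden x) (hp : I.pol x = .neg) :
    ¬ Acc I.Step (I.dual x) := by
  obtain ⟨y, hy | ⟨hy1, -, rfl⟩, hn⟩ := exists_step_of_not_acc h
  · exact fun hacc => hn (acc_of_ile (ile_dual_of_le hx hp hy.1 hy.2) hacc)
  · rwa [I.dual_dual y hy1]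

/-- Synchronisation links end only at hidden negative events, so here the last step is causal within
one augmentation. -/
theorem exists_lt_of_not_acc {x : E} (h : ¬ Acc I.Step x) (hp : I.pol x = .pos ∨ ¬ I.hidden x) :
    ∃ y, I.le y x ∧ y ≠ x ∧ ¬ Acc I.Step y := by
  obtain ⟨y, hy | ⟨hy1, hy2, rfl⟩, hn⟩ := exists_step_of_not_acc h
  · exact ⟨y, hy.1, hy.2, hn⟩
  · rcases hp with hp | hp
    · rw [pol_dual_of_pos hy1 hy2] at hp
      cases hp
    · exact absurd (I.hidden_dual y hy1) hp

/-- Below a positive event on or above a causal loop, there is another hidden positive one, whose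
justifier is above that of the first. -/
theorem exists_not_acc_of_pos {x : E} (h : ¬ Acc I.Step x) (hp : I.pol x = .pos) :
    ∃ y, ¬ Acc I.Step y ∧ I.hidden y ∧ I.pol y = .pos ∧
      (∀ c, Imm I.sle c y → Acc I.Step c) ∧ I.side y = !I.side x ∧
      ∀ c, Imm I.sle c x → Acc I.Step c →
        ∃ d, Imm I.sle d y ∧ Relation.TransGen I.Step c d := by
  obtain ⟨x', h1, h2, h3⟩ := exists_lt_of_not_acc h (Or.inl hp)
  -- `z` is the lowest non-accessible event below `x'`. Being lowest forces it to be negative and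
  -- hidden, and the new event is `dual z`.
  obtain ⟨z, hz, hzx', hmin⟩ := I.forest.exists_minimal_mem (fun y => ¬ Acc I.Step y) h3
  have hzx := I.forest.trans _ _ _ hzx' h1
  have hzne : z ≠ x := fun e => by
    subst e
    exact h2 (I.forest.antisymm _ _ h1 hzx')
  have hzh : ¬ (I.pol z = .pos ∨ ¬ I.hidden z) := fun hor => by
    obtain ⟨y, hy1, hy2, hy3⟩ := exists_lt_of_not_acc hz hor
    exact hy2 (hmin y hy1 hy3)
  rw [not_or, not_not] at hzh
  obtain ⟨hzp, hzh⟩ := hzh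
  replace hzp := Polarity.ne_pos_iff.1 hzp
  refine ⟨I.dual z, not_acc_dual hz hzh hzp, I.hidden_dual z hzh, pol_dual_of_neg hzh hzp,
    fun c hc => ?_, ?_, fun c hc hacc => ?_⟩
  -- If a justifier `c` of `dual z` were not accessible, neither would be `dual c`, which lies
  -- strictly below `z`.
  · by_contra hn
    have hch := (I.hidden_iff _ _ hc.1).2 (I.hidden_dual z hzh)
    have hk := imm_dual hch hc
    rw [I.dual_dual z hzh] at hk
    have hcn := pol_neg_of_simm_of_pos hc (pol_dual_of_neg hzh hzp)
    exact hk.2.1 (hmin _ (I.ruleAbiding _ _ hk.1) (not_acc_dual hn hch hcn))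
  · rw [I.side_dual z hzh, I.side_le z x hzx]
  -- `c` and `z` are comparable, both being below `x`, and `z` is not below the accessible `c`. So
  -- `c` is below the justifier `d` of `z`, whose dual justifies `dual z`.
  · have hcz : I.le c z := by
      rcases I.forest.linear_below x c z (I.ruleAbiding _ _ hc.1) hzx with k | k
      · exact k
      · exact absurd (acc_of_ile (ile_of_le k) hacc) hz
    have hne : c ≠ z := fun e => hz (e ▸ hacc)
    obtain ⟨d, hd, hcd, hdp⟩ := exists_justifier hzp hcz hne
    have hdh := (I.hidden_iff _ _ hd.1).2 hzh
    refine ⟨I.dual d, imm_dual hdh hd, ?_⟩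
    exact (Relation.TransGen.tail' (ile_of_le hcd) (Or.inr ⟨hdh, hdp, rfl⟩))

theorem acc_of_transGen_self {α : Type} {r : α → α → Prop} {a : α}
    (h : Relation.TransGen r a a) : ¬ Acc r a := by
  intro hacc
  replace hacc := hacc.transGen
  induction hacc with
  | intro x _ ih => exact ih x h h

/-- Iterating `exists_not_acc_of_pos` makes the accessible justifiers climb strictly in a finite
set. What remains is to reach a non-accessible positive event that has an accessible justifier. -/
theorem step_wf (I : Interaction E) : WellFounded I.Step := by
  have := I.finite
  -- Induction goes upwards along causality. It is restricted to accessible events, where the strict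
  -- order is irreflexive.
  have no : ∀ (c : {c // Acc I.Step c}) (x : E), ¬ Acc I.Step x → I.pol x = .pos →
      Imm I.sle c.1 x → False := by
    let R : {c // Acc I.Step c} → {c // Acc I.Step c} → Prop :=
      fun a b => Relation.TransGen I.Step b.1 a.1
    have hR : IsTrans _ R := ⟨fun a b c h1 h2 => h2.trans h1⟩
    have hR' : Std.Irrefl R := ⟨fun a h => acc_of_transGen_self h a.2⟩
    have wf : WellFounded R := Finite.wellFounded_of_trans_of_irrefl R
    intro c
    induction c using wf.induction with
    | h c ih =>
      intro x hx hp hc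
      obtain ⟨y, hy, hyh, hyp, hyacc, -, hyc⟩ := exists_not_acc_of_pos hx hp
      obtain ⟨d, hd, hcd⟩ := hyc c.1 hc c.2
      exact ih ⟨d, hyacc d hd⟩ hcd y hy hyp hd
  -- On side `false`, a hidden positive event is not statically minimal, so it has a justifier to
  -- which `no` applies.
  have no' : ∀ x, I.hidden x → I.side x = false → I.pol x = .pos →
      (∀ c, Imm I.sle c x → Acc I.Step c) → Acc I.Step x := by
    intro x hx hs hp hacc
    by_contra hn
    have : ¬ IsMinimal I.sle x := fun hm => by
      rw [I.side_minimal x hx hp hm] at hs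
      cases hs
    unfold IsMinimal at this
    push Not at this
    obtain ⟨b, hb, hne⟩ := this
    obtain ⟨c, -, hc⟩ := I.sle_forest.exists_imm_below hb hne
    exact no ⟨c, hacc c hc⟩ x hn hp hc
  have pos : ∀ x, I.pol x = .pos → Acc I.Step x := by
    intro x hp
    by_contra hn
    -- Each application changes side, so after two of them one of `y` and `z` is on side `false`.
    obtain ⟨y, hy, hyh, hyp, hyacc, hys, -⟩ := exists_not_acc_of_pos hn hp
    obtain ⟨z, hz, hzh, hzp, hzacc, hzs, -⟩ := exists_not_acc_of_pos hy hyp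
    cases hs : I.side y
    · exact hy (no' y hyh hs hyp hyacc)
    · exact hz (no' z hzh (by rw [hzs, hs]; rfl) hzp hzacc)
  refine ⟨fun x => ?_⟩
  rcases (I.pol x).eq_pos_or_neg with hp | hp
  · exact pos x hp
  by_contra hn
  by_cases hx : I.hidden x
  · exact not_acc_dual hn hx hp (pos _ (pol_dual_of_neg hx hp))
  · obtain ⟨y, hy1, hy2, hy3⟩ := exists_lt_of_not_acc hn (Or.inr hx)
    obtain ⟨c, -, hc, hcp⟩ := exists_justifier hp hy1 hy2
    exact hy3 (acc_of_ile (ile_of_le hc) (pos c hcp))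

theorem ile_antisymm {a b : E} (h1 : I.ile a b) (h2 : I.ile b a) : a = b := by
  rcases Relation.reflTransGen_iff_eq_or_transGen.1 h1 with e | h
  · exact e.symm
  · exact absurd (I.step_wf.apply a) (acc_of_transGen_self (h.trans_left h2))

/-! ### The interaction is a forest -/

/-- The events of the interaction strictly below a given one have a greatest element, if any. -/
theorem exists_parent (c : E) (hc : I.pol c = .neg → I.hidden c) :
    ∃ d, I.ile d c ∧ d ≠ c ∧ (I.pol c = .pos → Imm I.le d c) ∧
      ∀ a, I.ile a c → a = c ∨ I.ile a d := by
  rcases (I.pol c).eq_pos_or_neg with hp | hp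
  · have hm : ¬ IsMinimal I.le c := fun hm => by
      have := I.negative c hm
      rw [hp] at this
      cases this
    unfold IsMinimal at hm
    push Not at hm
    obtain ⟨b, hb, hne⟩ := hm
    obtain ⟨d, -, hd⟩ := I.forest.exists_imm_below hb hne
    refine ⟨d, ile_of_le hd.1, hd.2.1, fun _ => hd,
      fun a hac => ?_⟩
    -- The last step of a path to a positive event cannot be a synchronisation, so it passes through
    -- the immediate predecessor `d`.
    rcases Relation.ReflTransGen.cases_tail hac with e | ⟨e, hae, he | ⟨he1, he2, rfl⟩⟩
    · exact Or.inl e.symm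
    · obtain ⟨d', hed', hd'⟩ := I.forest.exists_imm_below he.1 he.2
      have : d' = d := by
        rcases I.forest.linear_below c d' d hd'.1 hd.1 with k | k
        · exact ((hd'.2.2 d k hd.1).resolve_right hd.2.1).symm
        · exact (hd.2.2 d' k hd'.1).resolve_right hd'.2.1
      rw [this] at hed'
      exact Or.inr (hae.trans (ile_of_le hed'))
    · rw [pol_dual_of_pos he1 he2] at hp
      cases hp
  · have hh := hc hp
    have hdc : I.ile (I.dual c) c := by
      have := ile_dual (I.hidden_dual c hh) (pol_dual_of_neg hh hp)
      rwa [I.dual_dual c hh] at this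
    refine ⟨I.dual c, hdc, fun e => ?_, fun h => absurd (hp.symm.trans h) (by simp),
      fun a hac => ?_⟩
    · have := pol_dual_of_neg hh hp
      rw [e, hp] at this
      cases this
    · rcases Relation.ReflTransGen.cases_tail hac with e | ⟨e, hae, he | ⟨he1, he2, rfl⟩⟩
      · exact Or.inl e.symm
      · exact Or.inr (hae.trans (ile_dual_of_le hh hp he.1 he.2))
      · rw [I.dual_dual e he1]
        exact Or.inr hae

/-- Below a visible negative event, there is only what is below its justifier. -/
theorem exists_parent_of_visible {a c : E} (hp : I.pol c = .neg) (hc : ¬ I.hidden c)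
    (hac : I.ile a c) (hne : a ≠ c) : ∃ d, Imm I.sle d c ∧ I.ile a d := by
  rcases Relation.ReflTransGen.cases_tail hac with e | ⟨e, hae, he | ⟨he1, he2, rfl⟩⟩
  · exact absurd e.symm hne
  · obtain ⟨d, hd, hed, -⟩ := exists_justifier hp he.1 he.2
    exact ⟨d, hd, hae.trans (ile_of_le hed)⟩
  · exact absurd (I.hidden_dual e he1) hc

/-- Linearity is by induction on the event: its strict causes all lie below a single strict cause,
namely the parent or, for a visible negative event, the unique justifier. -/
theorem ile_forest (I : Interaction E) : IsForest I.ile where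
  refl _ := .refl
  antisymm _ _ := ile_antisymm
  trans _ _ _ := Relation.ReflTransGen.trans
  finite_below a := by
    have := I.finite
    exact Set.toFinite _
  linear_below a := by
    have wf := I.step_wf.transGen
    induction a using wf.induction with
    | h a ih =>
      intro b c hb hc
      by_cases eb : b = a
      · rw [eb]; exact Or.inr hc
      by_cases ec : c = a
      · rw [ec]; exact Or.inl hb
      have lt : ∀ {d}, I.ile d a → d ≠ a → Relation.TransGen I.Step d a := fun h hne =>
        (Relation.reflTransGen_iff_eq_or_transGen.1 h).resolve_left (Ne.symm hne)
      by_cases ha : I.pol a = .neg → I.hidden a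
      · obtain ⟨d, hd, hne, -, hd'⟩ := exists_parent a ha
        exact ih d (lt hd hne) b c ((hd' b hb).resolve_left eb) ((hd' c hc).resolve_left ec)
      · push Not at ha
        obtain ⟨d, hd, hbd⟩ := exists_parent_of_visible ha.1 ha.2 hb eb
        obtain ⟨d', hd', hcd⟩ := exists_parent_of_visible ha.1 ha.2 hc ec
        have : d' = d := by
          rcases I.sle_forest.linear_below a d' d hd'.1 hd.1 with k | k
          · exact ((hd'.2.2 d k hd.1).resolve_right hd.2.1).symm
          · exact (hd.2.2 d' k hd'.1).resolve_right hd'.2.1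
        rw [this] at hcd
        exact ih d (lt (ile_of_le (I.ruleAbiding _ _ hd.1)) hd.2.1) b c hbd hcd

/-! ### Chains of hidden events between visible ones -/

/-- A visible event triggers no synchronisation, and the immediate successors of a positive event
are static by courtesy. -/
theorem exists_child_of_visible {a b : E} (hp : I.pol a = .pos) (ha : ¬ I.hidden a)
    (hab : I.ile a b) (hne : a ≠ b) : ∃ d, Imm I.sle a d ∧ I.ile d b := by
  rcases Relation.ReflTransGen.cases_head hab with e | ⟨e, he | ⟨he1, -⟩, heb⟩
  · exact absurd e hne
  · obtain ⟨d, hd, hde⟩ := I.forest.exists_imm_above he.1 he.2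
    exact ⟨d, I.courteous a d hd (Or.inl hp), (ile_of_le hde).trans heb⟩
  · exact absurd he1 ha

/-- A successor exists because maximal events are positive, and determinism makes it unique. No
synchronisation leaves a negative event, so every path upwards goes through that successor. -/
theorem exists_child_of_neg {a : E} (hp : I.pol a = .neg) :
    ∃ s, Imm I.le a s ∧ I.pol s = .pos ∧ ∀ b, I.ile a b → a ≠ b → I.ile s b := by
  have hm : ¬ IsMaximal I.le a := fun hm => by
    have := I.covered a hm
    rw [hp] at this
    cases this
  unfold IsMaximal at hm
  push Not at hm
  obtain ⟨c, hc, hne⟩ := hm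
  obtain ⟨s, hs, -⟩ := I.forest.exists_imm_above hc (Ne.symm hne)
  have hsp := pol_pos_of_imm_of_neg hs hp
  refine ⟨s, hs, hsp, fun b hab hne => ?_⟩
  rcases Relation.ReflTransGen.cases_head hab with e | ⟨e, he | ⟨-, he2, -⟩, heb⟩
  · exact absurd e hne
  · obtain ⟨d, hd, hde⟩ := I.forest.exists_imm_above he.1 he.2
    rw [I.deterministic a s d hp hsp (pol_pos_of_imm_of_neg hd hp) hs hd]
    exact (ile_of_le hde).trans heb
  · rw [hp] at he2
    cases he2

/-- The counterpart of `ile_dual_of_le` above an event: an immediate successor of `a` is static and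
negative, hence triggered by its dual, which is itself above `dual a`. -/
theorem ile_dual_of_hidden {a b : E} (hp : I.pol a = .pos) (ha : I.hidden a)
    (hab : I.ile a b) (hne : a ≠ b) : I.ile (I.dual a) b := by
  rcases Relation.ReflTransGen.cases_head hab with e | ⟨e, he | ⟨-, -, rfl⟩, heb⟩
  · exact absurd e hne
  · obtain ⟨d, hd, hde⟩ := I.forest.exists_imm_above he.1 he.2
    have hs := I.courteous a d hd (Or.inl hp)
    have hdh := (I.hidden_iff _ _ hs.1).1 ha
    have hdp : I.pol d = .neg := by
      have := I.alternating a d hs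
      rw [hp] at this
      exact Polarity.ne_pos_iff.1 this.symm
    have k := ile_dual (I.hidden_dual d hdh) (pol_dual_of_neg hdh hdp)
    rw [I.dual_dual d hdh] at k
    exact ((ile_of_le (I.ruleAbiding _ _ (imm_dual ha hs).1)).trans k).trans
      ((ile_of_le hde).trans heb)
  · exact heb

theorem flip_wf (I : Interaction E) :
    WellFounded (fun a b => Relation.TransGen I.Step b a) := by
  have := I.finite
  have hR : IsTrans E (fun a b => Relation.TransGen I.Step b a) := ⟨fun a b c h1 h2 => h2.trans h1⟩
  have hR' : Std.Irrefl (fun a b => Relation.TransGen I.Step b a) :=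
    ⟨fun a h => acc_of_transGen_self h (I.step_wf.apply a)⟩
  exact Finite.wellFounded_of_trans_of_irrefl _

theorem step_of_imm {a b : E} (h : Imm I.le a b) : I.Step a b := Or.inl ⟨h.1, h.2.1⟩

/-- Move to the positive successor; if it is hidden, its dual is a negative event strictly further
up. Finiteness and the absence of loops stop the process at a visible event. -/
theorem exists_visible_above {a : E} (hp : I.pol a = .neg) :
    ∃ b, ¬ I.hidden b ∧ Relation.TransGen I.Step a b := by
  induction a using I.flip_wf.induction with
  | h a ih =>
    obtain ⟨s, hs, hsp, -⟩ := exists_child_of_neg hp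
    by_cases hsh : I.hidden s
    · have k : Relation.TransGen I.Step a (I.dual s) :=
        .tail (.single (step_of_imm hs)) (Or.inr ⟨hsh, hsp, rfl⟩)
      obtain ⟨b, hb, hsb⟩ := ih (I.dual s) k (pol_dual_of_pos hsh hsp)
      exact ⟨b, hb, k.trans hsb⟩
    · exact ⟨s, hsh, .single (step_of_imm hs)⟩

theorem exists_visible_below {a : E} (hp : I.pol a = .pos) :
    ∃ b, ¬ I.hidden b ∧ Relation.TransGen I.Step b a := by
  induction a using I.step_wf.transGen.induction with
  | h a ih =>
    obtain ⟨d, -, -, hd, -⟩ := exists_parent a (fun h => by rw [hp] at h; cases h)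
    replace hd := hd hp
    have hdp := pol_neg_of_imm_of_pos hd hp
    by_cases hdh : I.hidden d
    · have hstep : I.Step (I.dual d) d :=
        Or.inr ⟨I.hidden_dual d hdh, pol_dual_of_neg hdh hdp, (I.dual_dual d hdh).symm⟩
      have k : Relation.TransGen I.Step (I.dual d) a := .tail (.single hstep) (step_of_imm hd)
      obtain ⟨b, hb, hsb⟩ := ih (I.dual d) k (pol_dual_of_neg hdh hdp)
      exact ⟨b, hb, hsb.trans k⟩
    · exact ⟨d, hdh, .single (step_of_imm hd)⟩

/-- The chain of hidden events above a negative event is forced at every step, so it has one exit.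
The last two hypotheses say that `b` and `c` are lowest among the visible events strictly above `a`.
-/
theorem visible_above_unique {a b c : E} (hp : I.pol a = .neg)
    (hb : ¬ I.hidden b) (hc : ¬ I.hidden c) (hab : I.ile a b) (hac : I.ile a c)
    (hab' : a ≠ b) (hac' : a ≠ c)
    (hb' : ∀ d, ¬ I.hidden d → I.ile a d → a ≠ d → I.ile d b → d = b)
    (hc' : ∀ d, ¬ I.hidden d → I.ile a d → a ≠ d → I.ile d c → d = c) : b = c := by
  induction a using I.flip_wf.induction with
  | h a ih =>
    obtain ⟨s, hs, hsp, hs'⟩ := exists_child_of_neg hp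
    have has := ile_of_le hs.1
    have hsb := hs' b hab hab'
    have hsc := hs' c hac hac'
    by_cases hsh : I.hidden s
    · have k : Relation.TransGen I.Step a (I.dual s) :=
        .tail (.single (step_of_imm hs)) (Or.inr ⟨hsh, hsp, rfl⟩)
      have ne : ∀ d, ¬ I.hidden d → I.dual s ≠ d := fun d hd e => hd (e ▸ I.hidden_dual s hsh)
      have sne : ∀ d, ¬ I.hidden d → s ≠ d := fun d hd e => hd (e ▸ hsh)
      have ne' : ∀ d, I.ile (I.dual s) d → a ≠ d := fun d h1 e => by
        rw [← e] at h1
        exact acc_of_transGen_self (k.trans_left h1) (I.step_wf.apply a)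
      exact ih (I.dual s) k (pol_dual_of_pos hsh hsp)
        (ile_dual_of_hidden hsp hsh hsb (sne b hb)) (ile_dual_of_hidden hsp hsh hsc (sne c hc))
        (ne b hb) (ne c hc)
        (fun d hd h1 _ => hb' d hd (k.to_reflTransGen.trans h1) (ne' d h1))
        (fun d hd h1 _ => hc' d hd (k.to_reflTransGen.trans h1) (ne' d h1))
    · rw [← hb' s hsh has hs.2.1 hsb, ← hc' s hsh has hs.2.1 hsc]

end Interaction

/-! ### Restrictions and sums of forests and configurations -/

theorem Polarity.flip_flip (a : Polarity) : a.flip.flip = a := by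
  cases a <;> rfl

theorem IsForest.comap {α β : Type} {r : α → α → Prop} (h : IsForest r) {v : β → α}
    (hv : Function.Injective v) : IsForest (fun a b => r (v a) (v b)) where
  refl _ := h.refl _
  antisymm _ _ h1 h2 := hv (h.antisymm _ _ h1 h2)
  trans _ _ _ h1 h2 := h.trans _ _ _ h1 h2
  finite_below a := (h.finite_below (v a)).preimage hv.injOn
  linear_below _ _ _ h1 h2 := h.linear_below _ _ _ h1 h2

section LiftRel

variable {α β : Type} {r : α → α → Prop} {s : β → β → Prop}

@[simp] theorem imm_liftRel_inl_inl {a b : α} :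
    Imm (Sum.LiftRel r s) (.inl a) (.inl b) ↔ Imm r a b := by
  simp [Imm]

@[simp] theorem imm_liftRel_inr_inr {a b : β} :
    Imm (Sum.LiftRel r s) (.inr a) (.inr b) ↔ Imm s a b := by
  simp [Imm]

@[simp] theorem not_imm_liftRel_inl_inr {a : α} {b : β} :
    ¬ Imm (Sum.LiftRel r s) (.inl a) (.inr b) := by
  simp [Imm]

@[simp] theorem not_imm_liftRel_inr_inl {a : α} {b : β} :
    ¬ Imm (Sum.LiftRel r s) (.inr b) (.inl a) := by
  simp [Imm]

@[simp] theorem isMinimal_liftRel_inl {a : α} :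
    IsMinimal (Sum.LiftRel r s) (.inl a) ↔ IsMinimal r a := by
  simp [IsMinimal]

@[simp] theorem isMinimal_liftRel_inr {b : β} :
    IsMinimal (Sum.LiftRel r s) (.inr b) ↔ IsMinimal s b := by
  simp [IsMinimal]

@[simp] theorem isMaximal_liftRel_inl {a : α} :
    IsMaximal (Sum.LiftRel r s) (.inl a) ↔ IsMaximal r a := by
  simp [IsMaximal]

@[simp] theorem isMaximal_liftRel_inr {b : β} :
    IsMaximal (Sum.LiftRel r s) (.inr b) ↔ IsMaximal s b := by
  simp [IsMaximal]

end LiftRel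

theorem IsConf.hom {A B : Arena} {X Y : Type} {r : X → X → Prop} {s : Y → Y → Prop}
    {d : X → A.Ev} {e : Y → B.Ev} (hr : IsConf A r d) (hs : IsConf B s e) :
    IsConf (A.hom B) (Sum.LiftRel r s) (Sum.map d e) where
  finite := by
    have := hr.finite
    have := hs.finite
    infer_instance
  forest := hr.forest.sum hs.forest
  minimal_iff := by
    rintro (a | a)
    · simpa using hr.minimal_iff a
    · simpa using hs.minimal_iff a
  imm := by
    rintro (a | a) (b | b) h
    · simpa using hr.imm a b (by simpa using h)
    · simp at h
    · simp at h
    · simpa using hs.imm a b (by simpa using h)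

/-! ### Augmentation axioms for the visible events -/

namespace Interaction

variable {E W : Type} {I : Interaction E} {v : W → E}

/-- At a visible positive source or a visible negative target, the adjacent event of a path may be
taken to be a static neighbour. Static neighbours of visible events are visible, so an immediate
link has no room for a third event and is itself static. -/
theorem visible_courteous (hr : ∀ e, ¬ I.hidden e → ∃ w, v w = e) (hW : ∀ w, ¬ I.hidden (v w))
    (hv : Function.Injective v) {a b : W} (h : Imm (fun w w' => I.ile (v w) (v w')) a b)
    (hp : I.pol (v a) = .pos ∨ I.pol (v b) = .neg) :
    Imm (fun w w' => I.sle (v w) (v w')) a b := by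
  obtain ⟨h1, h2, h3⟩ := h
  suffices hs : Imm I.sle (v a) (v b) from
    ⟨hs.1, h2, fun c k1 k2 => (hs.2.2 (v c) k1 k2).imp (fun e => hv e) (fun e => hv e)⟩
  rcases hp with hp | hp
  · obtain ⟨d, hd, hdb⟩ := exists_child_of_visible hp (hW a) h1 (fun e => h2 (hv e))
    obtain ⟨w, rfl⟩ := hr d fun hn => hW a ((I.hidden_iff _ _ hd.1).2 hn)
    rcases h3 w (ile_of_le (I.ruleAbiding _ _ hd.1)) hdb with rfl | rfl
    · exact absurd rfl hd.2.1
    · exact hd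
  · obtain ⟨d, hd, hbd⟩ := exists_parent_of_visible hp (hW b) h1 (fun e => h2 (hv e))
    obtain ⟨w, rfl⟩ := hr d fun hn => hW b ((I.hidden_iff _ _ hd.1).1 hn)
    rcases h3 w hbd (ile_of_le (I.ruleAbiding _ _ hd.1)) with rfl | rfl
    · exact hd
    · exact absurd rfl hd.2.1

theorem visible_deterministic (hr : ∀ e, ¬ I.hidden e → ∃ w, v w = e)
    (hW : ∀ w, ¬ I.hidden (v w)) (hv : Function.Injective v) {a b c : W}
    (ha : I.pol (v a) = .neg) (hb : Imm (fun w w' => I.ile (v w) (v w')) a b)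
    (hc : Imm (fun w w' => I.ile (v w) (v w')) a c) : b = c := by
  refine hv (visible_above_unique ha (hW b) (hW c) hb.1 hc.1 (fun e => hb.2.1 (hv e))
    (fun e => hc.2.1 (hv e)) (fun d hd k1 k2 k3 => ?_) (fun d hd k1 k2 k3 => ?_))
  · obtain ⟨w, rfl⟩ := hr d hd
    rcases hb.2.2 w k1 k3 with rfl | rfl
    · exact absurd rfl k2
    · rfl
  · obtain ⟨w, rfl⟩ := hr d hd
    rcases hc.2.2 w k1 k3 with rfl | rfl
    · exact absurd rfl k2
    · rfl

theorem visible_covered (hr : ∀ e, ¬ I.hidden e → ∃ w, v w = e)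
    {a : W} (h : IsMaximal (fun w w' => I.ile (v w) (v w')) a) : I.pol (v a) = .pos := by
  by_contra hn
  obtain ⟨b, hb, hab⟩ := exists_visible_above (Polarity.ne_pos_iff.1 hn)
  obtain ⟨w, rfl⟩ := hr b hb
  rw [h w hab.to_reflTransGen] at hab
  exact acc_of_transGen_self hab (I.step_wf.apply _)

theorem visible_negative (hr : ∀ e, ¬ I.hidden e → ∃ w, v w = e)
    {a : W} (h : IsMinimal (fun w w' => I.ile (v w) (v w')) a) : I.pol (v a) = .neg := by
  by_contra hn
  obtain ⟨b, hb, hab⟩ := exists_visible_below (Polarity.ne_neg_iff.1 hn)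
  obtain ⟨w, rfl⟩ := hr b hb
  rw [h w hab.to_reflTransGen] at hab
  exact acc_of_transGen_self hab (I.step_wf.apply _)

end Interaction

/-! ### Composition of augmentations -/

section Comp

variable {A B C : Arena} {q : Aug (A.hom B)} {p : Aug (B.hom C)}

theorem Aug.disp_left (p : Aug (A.hom B)) (m : p.deseq.left.Ev) :
    p.disp m.1 = Sum.inl (p.deseq.left.disp m) :=
  (Sum.inl_getLeft _ _).symm

theorem Aug.disp_right (p : Aug (A.hom B)) (m : p.deseq.right.Ev) :
    p.disp m.1 = Sum.inr (p.deseq.right.disp m) :=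
  (Sum.inr_getRight _ _).symm

theorem Aug.pol_left (p : Aug (A.hom B)) (m : p.deseq.left.Ev) :
    p.pol m.1 = (A.pol (p.deseq.left.disp m)).flip := by
  change Sum.elim _ _ (p.disp m.1) = _
  rw [p.disp_left m]
  rfl

theorem Aug.pol_right (p : Aug (A.hom B)) (m : p.deseq.right.Ev) :
    p.pol m.1 = B.pol (p.deseq.right.disp m) := by
  change Sum.elim _ _ (p.disp m.1) = _
  rw [p.disp_right m]
  rfl

theorem Aug.isRight_iff_of_sle (q : Aug (A.hom B)) {m n : q.Ev} (h : q.sle m n) :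
    (q.disp m).isRight = true ↔ (q.disp n).isRight = true := by
  have := q.isAug.conf.le_of_le m n h
  generalize q.disp m = x at *
  generalize q.disp n = y at *
  cases this <;> simp

theorem Aug.isLeft_iff_of_sle (q : Aug (A.hom B)) {m n : q.Ev} (h : q.sle m n) :
    (q.disp m).isLeft = true ↔ (q.disp n).isLeft = true := by
  have := q.isAug.conf.le_of_le m n h
  generalize q.disp m = x at *
  generalize q.disp n = y at *
  cases this <;> simp

theorem Aug.alternating (q : Aug A) {m n : q.Ev} (h : Imm q.sle m n) : q.pol m ≠ q.pol n :=
  A.alternating _ _ (q.isAug.conf.imm m n h)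

theorem pol_symmetry (φ : q.deseq.right.Symmetry p.deseq.left) (m : q.deseq.right.Ev) :
    p.pol (φ.1 m).1 = (q.pol m.1).flip := by
  rw [p.pol_left, q.pol_right, φ.2]

theorem pol_symmetry_symm (φ : q.deseq.right.Symmetry p.deseq.left) (m : p.deseq.left.Ev) :
    q.pol (φ.1.symm m).1 = (p.pol m.1).flip := by
  have := pol_symmetry φ (φ.1.symm m)
  rw [RelIso.apply_symm_apply] at this
  rw [this, Polarity.flip_flip]

/-- The synchronisation of hidden events induced by a symmetry. -/
def interDual (φ : q.deseq.right.Symmetry p.deseq.left) : q.Ev ⊕ p.Ev → q.Ev ⊕ p.Ev :=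
  Sum.elim
    (fun m => if h : (q.disp m).isRight = true then .inr (φ.1 ⟨m, h⟩).1 else .inl m)
    (fun m => if h : (p.disp m).isLeft = true then .inl (φ.1.symm ⟨m, h⟩).1 else .inr m)

theorem interDual_inl (φ : q.deseq.right.Symmetry p.deseq.left) (m : q.deseq.right.Ev) :
    interDual φ (.inl m.1) = .inr (φ.1 m).1 := by
  exact dif_pos m.2

theorem interDual_inr (φ : q.deseq.right.Symmetry p.deseq.left) (m : p.deseq.left.Ev) :
    interDual φ (.inr m.1) = .inl (φ.1.symm m).1 := by
  exact dif_pos m.2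

/-- The interaction of `q` and `p` via `φ`. -/
def interaction (hB : ∀ b, IsMinimal B.le b → B.pol b = .neg)
    (φ : q.deseq.right.Symmetry p.deseq.left) : Interaction (q.Ev ⊕ p.Ev) where
  le := Sum.LiftRel q.le p.le
  sle := Sum.LiftRel q.sle p.sle
  pol := Sum.elim q.pol p.pol
  hidden := Sum.elim (fun m => (q.disp m).isRight = true) (fun m => (p.disp m).isLeft = true)
  dual := interDual φ
  side := Sum.isRight
  finite := by
    have := q.isAug.conf.finite
    have := p.isAug.conf.finite
    infer_instance
  forest := q.isAug.forest.sum p.isAug.forest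
  sle_forest := q.isAug.conf.forest.sum p.isAug.conf.forest
  ruleAbiding _ _ h := h.mono q.isAug.ruleAbiding p.isAug.ruleAbiding
  alternating := by
    rintro (a | a) (b | b) h
    · exact q.alternating (by simpa using h)
    · simp at h
    · simp at h
    · exact p.alternating (by simpa using h)
  courteous := by
    rintro (a | a) (b | b) h hp
    · simpa using q.isAug.courteous a b (by simpa using h) hp
    · simp at h
    · simp at h
    · simpa using p.isAug.courteous a b (by simpa using h) hp
  deterministic := by
    rintro (a | a) (b | b) (c | c) ha hb hc h1 h2 <;> simp at h1 h2
    · exact congrArg _ (q.isAug.deterministic a b c ha hb hc h1 h2)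
    · exact congrArg _ (p.isAug.deterministic a b c ha hb hc h1 h2)
  covered := by
    rintro (a | a) h
    · exact q.isAug.covered a (by simpa using h)
    · exact p.isAug.covered a (by simpa using h)
  negative := by
    rintro (a | a) h
    · exact q.isAug.negative a (by simpa using h)
    · exact p.isAug.negative a (by simpa using h)
  hidden_iff := by
    rintro (a | a) (b | b) h
    · exact q.isRight_iff_of_sle (by simpa using h)
    · simp at h
    · simp at h
    · exact p.isLeft_iff_of_sle (by simpa using h)
  hidden_dual := by
    rintro (a | a) h
    · rw [interDual_inl φ ⟨a, h⟩]
      exact (φ.1 ⟨a, h⟩).2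
    · rw [interDual_inr φ ⟨a, h⟩]
      exact (φ.1.symm ⟨a, h⟩).2
  dual_dual := by
    rintro (a | a) h
    · rw [interDual_inl φ ⟨a, h⟩, interDual_inr]
      exact congrArg (fun m => Sum.inl m.1) (φ.1.symm_apply_apply ⟨a, h⟩)
    · rw [interDual_inr φ ⟨a, h⟩, interDual_inl]
      exact congrArg (fun m => Sum.inr m.1) (φ.1.apply_symm_apply ⟨a, h⟩)
  pol_dual := by
    rintro (a | a) h
    · rw [interDual_inl φ ⟨a, h⟩]
      exact pol_symmetry φ ⟨a, h⟩
    · rw [interDual_inr φ ⟨a, h⟩]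
      exact pol_symmetry_symm φ ⟨a, h⟩
  sle_dual := by
    rintro (a | a) (b | b) ha hb h
    · rw [interDual_inl φ ⟨a, ha⟩, interDual_inl φ ⟨b, hb⟩]
      exact .inr ((φ.1.map_rel_iff (a := ⟨a, ha⟩) (b := ⟨b, hb⟩)).2 (Sum.liftRel_inl_inl.1 h :))
    · simp at h
    · simp at h
    · rw [interDual_inr φ ⟨a, ha⟩, interDual_inr φ ⟨b, hb⟩]
      exact .inl ((φ.1.symm.map_rel_iff (a := ⟨a, ha⟩) (b := ⟨b, hb⟩)).2 (Sum.liftRel_inr_inr.1 h :))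
  side_le := by
    rintro (a | a) (b | b) h <;> simp at h <;> rfl
  side_dual := by
    rintro (a | a) h
    · rw [interDual_inl φ ⟨a, h⟩]
      rfl
    · rw [interDual_inr φ ⟨a, h⟩]
      rfl
  -- The only use of the negativity of `B`: a minimal event of `q` displayed to `B` is negative in
  -- `q`, so a minimal hidden positive event belongs to `p`.
  side_minimal := by
    rintro (a | a) h hp hm
    · rw [isMinimal_liftRel_inl] at hm
      have h1 := (q.isAug.conf.minimal_iff a).1 hm
      rw [q.disp_right ⟨a, h⟩, isMinimal_liftRel_inr] at h1
      exact absurd (hp.symm.trans ((q.pol_right ⟨a, h⟩).trans (hB _ h1))) (by simp)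
    · rfl

theorem interStep_iff (hB : ∀ b, IsMinimal B.le b → B.pol b = .neg)
    (φ : q.deseq.right.Symmetry p.deseq.left) (a b : q.Ev ⊕ p.Ev) :
    InterStep q p φ a b ↔ (interaction hB φ).Step a b := by
  constructor
  · rintro (⟨m, n, h1, h2⟩ | ⟨m, n, h1, h2⟩ | ⟨m, h⟩ | ⟨m, h⟩)
    · exact Or.inl ⟨.inl h1, by simpa using h2⟩
    · exact Or.inl ⟨.inr h1, by simpa using h2⟩
    · exact Or.inr ⟨m.2, h, (interDual_inl φ m).symm⟩
    · exact Or.inr ⟨m.2, h, (interDual_inr φ m).symm⟩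
  · rintro (⟨h1, h2⟩ | ⟨h1, h2, rfl⟩)
    · rcases h1 with h1 | h1
      · exact .inl _ _ h1 (fun e => h2 (congrArg _ e))
      · exact .inr _ _ h1 (fun e => h2 (congrArg _ e))
    · rcases a with a | a
      · have := InterStep.sync (φ := φ) ⟨a, h1⟩ h2
        rwa [← interDual_inl φ ⟨a, h1⟩] at this
      · have := InterStep.syncSymm (φ := φ) ⟨a, h1⟩ h2
        rwa [← interDual_inr φ ⟨a, h1⟩] at this

theorem interLe_iff (hB : ∀ b, IsMinimal B.le b → B.pol b = .neg)
    (φ : q.deseq.right.Symmetry p.deseq.left) (a b : q.Ev ⊕ p.Ev) :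
    interLe q p φ a b ↔ (interaction hB φ).ile a b := by
  have : InterStep q p φ = (interaction hB φ).Step := by
    ext a b
    exact interStep_iff hB φ a b
  rw [interLe, this, Interaction.ile]

theorem visible_injective (q : Aug (A.hom B)) (p : Aug (B.hom C)) :
    Function.Injective (visible q p) :=
  Sum.map_injective.2 ⟨Subtype.val_injective, Subtype.val_injective⟩

theorem comp_pol (φ : q.deseq.right.Symmetry p.deseq.left)
    (w : (PreAug.comp q p φ).Ev) :
    (PreAug.comp q p φ).pol w = Sum.elim q.pol p.pol (visible q p w) := by
  rcases w with w | w
  · exact (q.pol_left w).symm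
  · exact (p.pol_right w).symm

theorem comp_sle (φ : q.deseq.right.Symmetry p.deseq.left) :
    (PreAug.comp q p φ).sle =
      fun w w' => Sum.LiftRel q.sle p.sle (visible q p w) (visible q p w') := by
  ext a b
  change Sum.LiftRel _ _ a b ↔ _
  rcases a with a | a <;> rcases b with b | b
  · refine ⟨fun h => .inl ?_, fun h => .inl ?_⟩
    · exact (Sum.liftRel_inl_inl.1 h :)
    · exact ((Sum.liftRel_inl_inl (r := q.sle) (s := p.sle)).1 h :)
  · exact ⟨fun h => (Sum.not_liftRel_inl_inr h).elim, fun h => (Sum.not_liftRel_inl_inr h).elim⟩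
  · exact ⟨fun h => (Sum.not_liftRel_inr_inl h).elim, fun h => (Sum.not_liftRel_inr_inl h).elim⟩
  · refine ⟨fun h => .inr ?_, fun h => .inr ?_⟩
    · exact (Sum.liftRel_inr_inr.1 h :)
    · exact ((Sum.liftRel_inr_inr (r := q.sle) (s := p.sle)).1 h :)

theorem comp_isAug (hB : ∀ b, IsMinimal B.le b → B.pol b = .neg)
    (φ : q.deseq.right.Symmetry p.deseq.left) : (PreAug.comp q p φ).IsAug := by
  let I := interaction hB φ
  have hle : (PreAug.comp q p φ).le = fun w w' => I.ile (visible q p w) (visible q p w') := by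
    ext a b
    exact interLe_iff hB φ _ _
  have hr : ∀ e, ¬ I.hidden e → ∃ w, visible q p w = e := by
    rintro (e | e) h
    · exact ⟨.inl ⟨e, Sum.not_isRight.1 h⟩, rfl⟩
    · exact ⟨.inr ⟨e, Sum.not_isLeft.1 h⟩, rfl⟩
  have hW : ∀ w, ¬ I.hidden (visible q p w) := by
    rintro (w | w) h
    · have := w.2
      exact Sum.not_isRight.2 this h
    · have := w.2
      exact Sum.not_isLeft.2 this h
  have hv := visible_injective q p
  refine ⟨q.deseq.left.isConf.hom p.deseq.right.isConf, ?_, ?_, ?_, ?_, ?_, ?_⟩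
  · rw [hle]
    exact I.ile_forest.comap hv
  · intro a b h
    rw [hle]
    rw [comp_sle] at h
    exact Interaction.ile_of_le (I.ruleAbiding _ _ h)
  · intro a b h hp
    rw [comp_sle]
    rw [hle] at h
    rw [comp_pol, comp_pol] at hp
    exact Interaction.visible_courteous hr hW hv h hp
  · intro a b c ha _ _ h1 h2
    rw [hle] at h1 h2
    rw [comp_pol] at ha
    exact Interaction.visible_deterministic hr hW hv ha h1 h2
  · intro a h
    rw [hle] at h
    rw [comp_pol]
    exact Interaction.visible_covered hr h
  · intro a h
    rw [hle] at h
    rw [comp_pol]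
    exact Interaction.visible_negative hr h

end Comp

/-! ### Copycat -/

section Copycat

variable {A : Arena} (x : Conf A)

/-- The event of `x` copied by an event of the copycat. -/
def copyBase : x.Ev ⊕ x.Ev → x.Ev := Sum.elim _root_.id _root_.id

/-- An explicit description of the causal order of the copycat: strictly increasing in `x`, or from
the negative to the positive copy of an event. -/
def CopyLe (a b : x.Ev ⊕ x.Ev) : Prop :=
  x.le (copyBase x a) (copyBase x b) ∧
    (copyBase x a = copyBase x b → a = b ∨ (PreAug.copycat x).pol a = .neg)

variable {x}

theorem copycat_pol_inl (m : x.Ev) :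
    (PreAug.copycat x).pol (.inl m : x.Ev ⊕ x.Ev) = (A.pol (x.disp m)).flip := rfl

theorem copycat_pol_inr (m : x.Ev) :
    (PreAug.copycat x).pol (.inr m : x.Ev ⊕ x.Ev) = A.pol (x.disp m) := rfl

theorem copycat_pol_swap (a : x.Ev ⊕ x.Ev) :
    (PreAug.copycat x).pol a.swap = ((PreAug.copycat x).pol a).flip := by
  rcases a with a | a
  · exact (Polarity.flip_flip _).symm
  · rfl

theorem copyBase_swap (a : x.Ev ⊕ x.Ev) : copyBase x a.swap = copyBase x a := by
  rcases a with a | a <;> rfl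

theorem swap_ne (a : x.Ev ⊕ x.Ev) : a.swap ≠ a := by
  rcases a with a | a <;> simp

theorem eq_or_eq_swap {a b : x.Ev ⊕ x.Ev} (h : copyBase x a = copyBase x b) :
    b = a ∨ b = a.swap := by
  rcases a with a | a <;> rcases b with b | b <;> simp_all [copyBase]

theorem Conf.alternating (x : Conf A) {m n : x.Ev} (h : Imm x.le m n) :
    A.pol (x.disp m) ≠ A.pol (x.disp n) :=
  A.alternating _ _ (x.isConf.imm m n h)

theorem CopyLe.refl (a : x.Ev ⊕ x.Ev) : CopyLe x a a :=
  ⟨x.isConf.forest.refl _, fun _ => Or.inl rfl⟩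

theorem CopyLe.trans {a b c : x.Ev ⊕ x.Ev} (h1 : CopyLe x a b) (h2 : CopyLe x b c) :
    CopyLe x a c := by
  refine ⟨x.isConf.forest.trans _ _ _ h1.1 h2.1, fun e => ?_⟩
  have e' : copyBase x a = copyBase x b := x.isConf.forest.antisymm _ _ h1.1 (e ▸ h2.1)
  rcases h1.2 e' with rfl | h
  · exact h2.2 e
  · exact Or.inr h

theorem CopyLe.of_lt {a b : x.Ev ⊕ x.Ev} (h : x.le (copyBase x a) (copyBase x b))
    (hne : copyBase x a ≠ copyBase x b) : CopyLe x a b :=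
  ⟨h, fun e => absurd e hne⟩

theorem CopyLe.swap {a : x.Ev ⊕ x.Ev} (h : (PreAug.copycat x).pol a = .neg) :
    CopyLe x a a.swap :=
  ⟨by rw [copyBase_swap]; exact x.isConf.forest.refl _, fun _ => Or.inr h⟩

theorem CopyLe.swap_self {a : x.Ev ⊕ x.Ev} (h : (PreAug.copycat x).pol a = .pos) :
    CopyLe x a.swap a := by
  have : CopyLe x a.swap a.swap.swap := .swap (by rw [copycat_pol_swap, h]; rfl)
  rwa [Sum.swap_swap] at this

theorem CopyLe.antisymm {a b : x.Ev ⊕ x.Ev} (h1 : CopyLe x a b) (h2 : CopyLe x b a) : a = b := by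
  have e := x.isConf.forest.antisymm _ _ h1.1 h2.1
  rcases eq_or_eq_swap e with rfl | rfl
  · rfl
  · rcases h1.2 e with h | h
    · exact h
    rcases h2.2 e.symm with h' | h'
    · exact h'.symm
    rw [copycat_pol_swap, h] at h'
    cases h'

/-- A change of copy is a generating step only at events of one polarity. At the other polarity
`CopyLe` forces `m ≠ n`, and the change is made at the immediate successor `c` of `m` towards `n`,
which has the opposite polarity. -/
theorem CopyLe.reflTransGen {a b : x.Ev ⊕ x.Ev} (h : CopyLe x a b) :
    Relation.ReflTransGen (CopycatStep x) a b := by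
  rcases a with m | m <;> rcases b with n | n <;> obtain ⟨h1, h2⟩ := h <;> change x.le m n at h1
  · exact .single (.inl m n h1)
  · rcases (A.pol (x.disp m)).eq_pos_or_neg with hp | hp
    · exact .single (.pos m n h1 hp)
    · have hne : m ≠ n := fun e => by
        rcases h2 e with h | h
        · cases h
        · rw [copycat_pol_inl, hp] at h
          cases h
      obtain ⟨c, hc, hcn⟩ := x.isConf.forest.exists_imm_above h1 hne
      have hcp := x.alternating hc
      rw [hp, ne_comm, Polarity.ne_neg_iff] at hcp
      exact .tail (.single (.inl m c hc.1)) (.pos c n hcn hcp)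
  · rcases (A.pol (x.disp m)).eq_pos_or_neg with hp | hp
    · have hne : m ≠ n := fun e => by
        rcases h2 e with h | h
        · cases h
        · rw [copycat_pol_inr, hp] at h
          cases h
      obtain ⟨c, hc, hcn⟩ := x.isConf.forest.exists_imm_above h1 hne
      have hcp := x.alternating hc
      rw [hp, ne_comm, Polarity.ne_pos_iff] at hcp
      exact .tail (.single (.inr m c hc.1)) (.neg c n hcn hcp)
    · exact .single (.neg m n h1 hp)
  · exact .single (.inr m n h1)

theorem copycat_le_iff (a b : x.Ev ⊕ x.Ev) : (PreAug.copycat x).le a b ↔ CopyLe x a b := by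
  refine ⟨fun h => ?_, CopyLe.reflTransGen⟩
  induction h with
  | refl => exact .refl _
  | tail _ h ih =>
    refine ih.trans ?_
    rcases h with ⟨m, n, h⟩ | ⟨m, n, h⟩ | ⟨m, n, h, hp⟩ | ⟨m, n, h, hp⟩
    · exact ⟨h, fun e => Or.inl (congrArg _ e)⟩
    · exact ⟨h, fun e => Or.inl (congrArg _ e)⟩
    · exact ⟨h, fun _ => Or.inr (by rw [copycat_pol_inl, hp]; rfl)⟩
    · exact ⟨h, fun _ => Or.inr (by rw [copycat_pol_inr, hp])⟩

/-- Whatever lies above a negative `a` over a different event of `x` also lies above the other copy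
of `a`, which is itself above `a`. -/
theorem imm_copyLe_of_neg {a b : x.Ev ⊕ x.Ev} (h : Imm (CopyLe x) a b)
    (ha : (PreAug.copycat x).pol a = .neg) : b = a.swap := by
  by_cases e : copyBase x a = copyBase x b
  · exact (eq_or_eq_swap e).resolve_left h.2.1.symm
  · have h1 : CopyLe x a.swap b := .of_lt (by rw [copyBase_swap]; exact h.1.1)
      (by rw [copyBase_swap]; exact e)
    exact ((h.2.2 _ (.swap ha) h1).resolve_left (swap_ne a)).symm

theorem copyLe_forest (x : Conf A) : IsForest (CopyLe x) where
  refl := .refl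
  antisymm _ _ := CopyLe.antisymm
  trans _ _ _ := CopyLe.trans
  finite_below a := by
    have := x.isConf.finite
    exact Set.toFinite _
  linear_below a b c hb hc := by
    by_cases e : copyBase x b = copyBase x c
    · rcases eq_or_eq_swap e with rfl | rfl
      · exact Or.inl (.refl _)
      · rcases ((PreAug.copycat x).pol b).eq_pos_or_neg with hp | hp
        · exact Or.inr (.swap_self hp)
        · exact Or.inl (.swap hp)
    · exact (x.isConf.forest.linear_below _ _ _ hb.1 hc.1).imp (fun h => .of_lt h e)
        (fun h => .of_lt h (Ne.symm e))

/-- Immediate links leaving negative events join the two copies of one event and are excluded by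
`hp`. The others go from positive to negative over an immediate link of `x`; alternation in `x` then
puts both ends in the same copy. -/
theorem copyLe_courteous {a b : x.Ev ⊕ x.Ev} (h : Imm (CopyLe x) a b)
    (hp : (PreAug.copycat x).pol a = .pos ∨ (PreAug.copycat x).pol b = .neg) :
    Imm (Sum.LiftRel x.le x.le) a b := by
  have ha : (PreAug.copycat x).pol a = .pos := by
    rcases ((PreAug.copycat x).pol a).eq_pos_or_neg with ha | ha
    · exact ha
    · rw [imm_copyLe_of_neg h ha, copycat_pol_swap, ha] at hp
      rcases hp with hp | hp <;> cases hp
  have e : copyBase x a ≠ copyBase x b := fun e => by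
    rcases h.1.2 e with h' | h'
    · exact h.2.1 h'
    · rw [ha] at h'
      cases h'
  -- Were `b` positive, its negative copy would lie strictly between `a` and `b`.
  have hb : (PreAug.copycat x).pol b = .neg := by
    by_contra hb
    rw [← ne_eq, Polarity.ne_neg_iff] at hb
    have h1 : CopyLe x b.swap b := .swap_self hb
    have h2 : CopyLe x a b.swap := .of_lt (by rw [copyBase_swap]; exact h.1.1)
      (by rw [copyBase_swap]; exact e)
    rcases h.2.2 _ h2 h1 with k | k
    · exact e (by rw [← k, copyBase_swap])
    · exact swap_ne b k
  have hi : Imm x.le (copyBase x a) (copyBase x b) := by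
    refine ⟨h.1.1, e, fun c h1 h2 => ?_⟩
    by_contra! hc
    rcases h.2.2 (.inl c) (.of_lt h1 hc.1.symm) (.of_lt h2 hc.2) with rfl | rfl
    · exact hc.1 rfl
    · exact hc.2 rfl
  have halt := x.alternating hi
  rcases a with a | a <;> rcases b with b | b
  · exact imm_liftRel_inl_inl.2 hi
  · rw [copycat_pol_inl, Polarity.flip_eq_pos_iff] at ha
    exact absurd (ha.trans hb.symm) halt
  · rw [copycat_pol_inl, Polarity.flip_eq_neg_iff] at hb
    exact absurd (ha.trans hb.symm) halt
  · exact imm_liftRel_inr_inr.2 hi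

theorem copycat_isAug (x : Conf A) : (PreAug.copycat x).IsAug := by
  have hle : (PreAug.copycat x).le = CopyLe x := by
    ext a b
    exact copycat_le_iff a b
  refine ⟨x.isConf.hom x.isConf, ?_, ?_, ?_, ?_, ?_, ?_⟩
  · rw [hle]
    exact copyLe_forest x
  · rintro a b (h | h)
    · exact .single (.inl _ _ h)
    · exact .single (.inr _ _ h)
  · intro a b h hp
    rw [hle] at h
    exact copyLe_courteous h hp
  · intro a b c ha _ _ h1 h2
    rw [hle] at h1 h2
    rw [imm_copyLe_of_neg h1 ha, imm_copyLe_of_neg h2 ha]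
  · intro a h
    rw [hle] at h
    by_contra hp
    exact swap_ne a (h _ (.swap (Polarity.ne_pos_iff.1 hp)))
  · intro a h
    rw [hle] at h
    by_contra hp
    exact swap_ne a (h _ (.swap_self (Polarity.ne_neg_iff.1 hp)))

end Copycat

/-! ### Symmetries -/

namespace Conf

variable {A B : Arena} {x y z : Conf A}

/-- The inverse of a symmetry. -/
def Symmetry.symm (φ : x.Symmetry y) : y.Symmetry x :=
  ⟨φ.1.symm, fun a => by
    have := φ.2 (φ.1.symm a)
    rw [RelIso.apply_symm_apply] at this
    exact this.symm⟩

/-- The composition of two symmetries. -/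
def Symmetry.trans (φ : x.Symmetry y) (ψ : y.Symmetry z) : x.Symmetry z :=
  ⟨φ.1.trans ψ.1, fun a => (ψ.2 (φ.1 a)).trans (φ.2 a)⟩

theorem Symmetry.ext {φ ψ : x.Symmetry y} (h : ∀ a, φ.1 a = ψ.1 a) : φ = ψ :=
  Subtype.ext (RelIso.ext h)

theorem Symmetry.symm_apply_apply (φ : x.Symmetry y) (a : x.Ev) : φ.1.symm (φ.1 a) = a :=
  φ.1.symm_apply_apply a

theorem Symmetry.apply_symm_apply (φ : x.Symmetry y) (a : y.Ev) : φ.1 (φ.1.symm a) = a :=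
  φ.1.apply_symm_apply a

/-- Symmetries transport along symmetries of their source and target. -/
def Symmetry.congr {x' y' : Conf A} (α : x.Symmetry x') (β : y.Symmetry y') :
    x.Symmetry y ≃ x'.Symmetry y' where
  toFun φ := (α.symm.trans φ).trans β
  invFun φ := (α.trans φ).trans β.symm
  left_inv φ := Symmetry.ext fun a =>
    (β.symm_apply_apply _).trans (congrArg φ.1 (α.symm_apply_apply a))
  right_inv φ := Symmetry.ext fun a =>
    (β.apply_symm_apply _).trans (congrArg φ.1 (α.apply_symm_apply a))

/-- Inverting symmetries is a bijection. -/
def Symmetry.inverse (x y : Conf A) : x.Symmetry y ≃ y.Symmetry x where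
  toFun φ := φ.symm
  invFun φ := φ.symm
  left_inv _ := rfl
  right_inv _ := rfl

/-- The identity symmetry. -/
def Symmetry.refl (x : Conf A) : x.Symmetry x := ⟨RelIso.refl _, fun _ => rfl⟩

/-- The configuration `x ⊢ y`. -/
def hom (x : Conf A) (y : Conf B) : Conf (A.hom B) where
  Ev := x.Ev ⊕ y.Ev
  le := Sum.LiftRel x.le y.le
  disp := Sum.map x.disp y.disp
  isConf := x.isConf.hom y.isConf

/-- The left restriction of `x ⊢ y` is `x`. -/
def homLeft (x : Conf A) (y : Conf B) : x.Symmetry (hom x y).left :=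
  ⟨{ toFun := fun m => ⟨.inl m, rfl⟩
     invFun := fun m => Sum.getLeft m.1 (by
       rcases m with ⟨m | m, h⟩
       · rfl
       · cases h)
     left_inv := fun m => rfl
     right_inv := by
       rintro ⟨m | m, h⟩
       · rfl
       · cases h
     map_rel_iff' := Sum.liftRel_inl_inl }, fun _ => rfl⟩

/-- The right restriction of `x ⊢ y` is `y`. -/
def homRight (x : Conf A) (y : Conf B) : y.Symmetry (hom x y).right :=
  ⟨{ toFun := fun m => ⟨.inr m, rfl⟩
     invFun := fun m => Sum.getRight m.1 (by
       rcases m with ⟨m | m, h⟩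
       · cases h
       · rfl)
     left_inv := fun m => rfl
     right_inv := by
       rintro ⟨m | m, h⟩
       · cases h
       · rfl
     map_rel_iff' := Sum.liftRel_inr_inr }, fun _ => rfl⟩

end Conf

/-! ### Synchronised events -/

section Link

variable {A B C : Arena} {q : Aug (A.hom B)} {p : Aug (B.hom C)}

/-- The events of `q` and `p` identified by the symmetry `φ`. -/
def Link (φ : q.deseq.right.Symmetry p.deseq.left) (a : q.Ev) (b : p.Ev) : Prop :=
  ∃ m : q.deseq.right.Ev, m.1 = a ∧ (φ.1 m).1 = b

variable {φ : q.deseq.right.Symmetry p.deseq.left}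

theorem interStep_inl_inl {a b : q.Ev} :
    InterStep q p φ (.inl a) (.inl b) ↔ q.le a b ∧ a ≠ b :=
  ⟨by rintro ⟨⟩; exact ⟨‹_›, ‹_›⟩, fun h => .inl a b h.1 h.2⟩

theorem interStep_inr_inr {a b : p.Ev} :
    InterStep q p φ (.inr a) (.inr b) ↔ p.le a b ∧ a ≠ b :=
  ⟨by rintro ⟨⟩; exact ⟨‹_›, ‹_›⟩, fun h => .inr a b h.1 h.2⟩

theorem interStep_inl_inr {a : q.Ev} {b : p.Ev} :
    InterStep q p φ (.inl a) (.inr b) ↔ Link φ a b ∧ q.pol a = .pos := by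
  constructor
  · rintro ⟨⟩
    exact ⟨⟨_, rfl, rfl⟩, ‹_›⟩
  · rintro ⟨⟨m, rfl, rfl⟩, h⟩
    exact .sync m h

theorem interStep_inr_inl {a : q.Ev} {b : p.Ev} :
    InterStep q p φ (.inr b) (.inl a) ↔ Link φ a b ∧ p.pol b = .pos := by
  constructor
  · rintro ⟨⟩
    exact ⟨⟨_, rfl, congrArg Subtype.val (φ.apply_symm_apply _)⟩, ‹_›⟩
  · rintro ⟨⟨m, rfl, rfl⟩, h⟩
    have := InterStep.syncSymm (φ := φ) (φ.1 m) h
    rwa [φ.symm_apply_apply] at this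

theorem interLe_inl {a b : q.Ev} (h : q.le a b) : interLe q p φ (.inl a) (.inl b) := by
  by_cases e : a = b
  · rw [e]
    exact .refl
  · exact .single (.inl _ _ h e)

theorem interLe_inr {a b : p.Ev} (h : p.le a b) : interLe q p φ (.inr a) (.inr b) := by
  by_cases e : a = b
  · rw [e]
    exact .refl
  · exact .single (.inr _ _ h e)

end Link

section CompSle

variable {A B C : Arena} {q : Aug (A.hom B)} {p : Aug (B.hom C)}
  (φ : q.deseq.right.Symmetry p.deseq.left)

theorem comp_sle_inl_inl (a b : q.deseq.left.Ev) :
    (PreAug.comp q p φ).sle (.inl a : _ ⊕ _) (.inl b : _ ⊕ _) ↔ q.sle a.1 b.1 :=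
  Sum.liftRel_inl_inl (r := q.deseq.left.le)

theorem comp_sle_inr_inr (a b : p.deseq.right.Ev) :
    (PreAug.comp q p φ).sle (.inr a : _ ⊕ _) (.inr b : _ ⊕ _) ↔ p.sle a.1 b.1 :=
  Sum.liftRel_inr_inr (s := p.deseq.right.le)

theorem not_comp_sle_inl_inr (a : q.deseq.left.Ev) (b : p.deseq.right.Ev) :
    ¬ (PreAug.comp q p φ).sle (.inl a : _ ⊕ _) (.inr b : _ ⊕ _) :=
  Sum.not_liftRel_inl_inr

theorem not_comp_sle_inr_inl (a : q.deseq.left.Ev) (b : p.deseq.right.Ev) :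
    ¬ (PreAug.comp q p φ).sle (.inr b : _ ⊕ _) (.inl a : _ ⊕ _) :=
  Sum.not_liftRel_inr_inl

end CompSle

/-! ### Invariance under isomorphism -/

theorem reflTransGen_equiv {α β : Type} {r : α → α → Prop} {s : β → β → Prop} (e : α ≃ β)
    (h : ∀ a b, s (e a) (e b) ↔ r a b) (a b : α) :
    Relation.ReflTransGen s (e a) (e b) ↔ Relation.ReflTransGen r a b := by
  constructor
  · intro k
    have := k.lift (p := r) e.symm fun a b hab => by
      rwa [Function.onFun, ← h, e.apply_symm_apply, e.apply_symm_apply]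
    rwa [Function.onFun, e.symm_apply_apply, e.symm_apply_apply] at this
  · exact fun k => k.lift e fun a b hab => (h a b).2 hab

section Invariance

variable {A B C : Arena}

/-- An isomorphism of the desequentializations of augmentations on `A ⊢ B` restricts to `A`. -/
def restrictLeft {q q' : Aug (A.hom B)} (e : q.Ev ≃ q'.Ev)
    (hs : ∀ a b, q'.sle (e a) (e b) ↔ q.sle a b) (hd : ∀ a, q'.disp (e a) = q.disp a) :
    q.deseq.left.Symmetry q'.deseq.left :=
  ⟨⟨e.subtypeEquiv fun a => by
      change Sum.isLeft (q.disp a) = true ↔ Sum.isLeft (q'.disp (e a)) = true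
      rw [hd], hs _ _⟩, fun a => by
    refine Sum.inl_injective ((q'.disp_left _).symm.trans (.trans ?_ (q.disp_left a)))
    exact hd a.1⟩

/-- An isomorphism of the desequentializations of augmentations on `A ⊢ B` restricts to `B`. -/
def restrictRight {q q' : Aug (A.hom B)} (e : q.Ev ≃ q'.Ev)
    (hs : ∀ a b, q'.sle (e a) (e b) ↔ q.sle a b) (hd : ∀ a, q'.disp (e a) = q.disp a) :
    q.deseq.right.Symmetry q'.deseq.right :=
  ⟨⟨e.subtypeEquiv fun a => by
      change Sum.isRight (q.disp a) = true ↔ Sum.isRight (q'.disp (e a)) = true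
      rw [hd], hs _ _⟩, fun a => by
    refine Sum.inr_injective ((q'.disp_right _).symm.trans (.trans ?_ (q.disp_right a)))
    exact hd a.1⟩

/-- Conjugating by the restrictions to `B` of the two isomorphisms preserves the synchronised pairs,
and with them the generating steps of the interaction. -/
theorem exists_symmetry_equiv {q q' : Aug (A.hom B)} {p p' : Aug (B.hom C)}
    (hq : q.toPreAug.Isomorphic q'.toPreAug) (hp : p.toPreAug.Isomorphic p'.toPreAug) :
    ∃ χ : q.deseq.right.Symmetry p.deseq.left ≃ q'.deseq.right.Symmetry p'.deseq.left,
      ∀ φ, (PreAug.comp q p φ).Isomorphic (PreAug.comp q' p' (χ φ)) := by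
  obtain ⟨e, e1, e2, e3⟩ := hq
  obtain ⟨f, f1, f2, f3⟩ := hp
  have epol : ∀ a, q'.pol (e a) = q.pol a := fun a => congrArg _ (e3 a)
  have fpol : ∀ a, p'.pol (f a) = p.pol a := fun a => congrArg _ (f3 a)
  refine ⟨Conf.Symmetry.congr (restrictRight e e1 e3) (restrictLeft f f1 f3), fun φ => ?_⟩
  set φ' := Conf.Symmetry.congr (restrictRight e e1 e3) (restrictLeft f f1 f3) φ with hφ'
  have hφ : ∀ m, φ'.1 ((restrictRight e e1 e3).1 m) = (restrictLeft f f1 f3).1 (φ.1 m) :=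
    fun m => congrArg (fun n => (restrictLeft f f1 f3).1 (φ.1 n))
      ((restrictRight e e1 e3).symm_apply_apply m)
  have hlink : ∀ a b, Link φ' (e a) (f b) ↔ Link φ a b := by
    intro a b
    constructor
    · rintro ⟨m, h1, h2⟩
      obtain ⟨m, rfl⟩ := (restrictRight e e1 e3).1.surjective m
      refine ⟨m, e.injective h1, f.injective ?_⟩
      rw [← h2, hφ]
      rfl
    · rintro ⟨m, rfl, rfl⟩
      exact ⟨(restrictRight e e1 e3).1 m, rfl, congrArg Subtype.val (hφ m)⟩
  refine ⟨Equiv.sumCongr (restrictLeft e e1 e3).1.toEquiv (restrictRight f f1 f3).1.toEquiv,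
    ?_, ?_, ?_⟩
  · rintro (a | a) (b | b)
    · exact (comp_sle_inl_inl φ' _ _).trans ((e1 _ _).trans (comp_sle_inl_inl φ a b).symm)
    · exact iff_of_false (not_comp_sle_inl_inr φ' _ _) (not_comp_sle_inl_inr φ a b)
    · exact iff_of_false (not_comp_sle_inr_inl φ' _ _) (not_comp_sle_inr_inl φ b a)
    · exact (comp_sle_inr_inr φ' _ _).trans ((f1 _ _).trans (comp_sle_inr_inr φ a b).symm)
  · intro a b
    have key := reflTransGen_equiv (r := InterStep q p φ) (s := InterStep q' p' φ')
      (Equiv.sumCongr e f) (by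
        rintro (a | a) (b | b)
        · simp [interStep_inl_inl, e2]
        · simp [interStep_inl_inr, hlink, epol]
        · simp [interStep_inr_inl, hlink, fpol]
        · simp [interStep_inr_inr, f2]) (visible q p a) (visible q p b)
    refine Iff.trans ?_ key
    rcases a with a | a <;> rcases b with b | b <;> exact Iff.rfl
  · rintro (a | a)
    · exact congrArg Sum.inl ((restrictLeft e e1 e3).2 a)
    · exact congrArg Sum.inr ((restrictRight f f1 f3).2 a)

end Invariance

/-! ### Associativity -/

/-- Paths between visible points are unaffected by contracting the paths inside a part `X`, if the
steps outside `X` connect visible points. -/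
theorem reflTransGen_hide {X Y Z : Type} {R : X → X → Prop} {S : Y → Y → Prop}
    {T : Z → Z → Prop} {i : X → Z} {v : Y → Z} (hi : Function.Injective i)
    (hv : Function.Injective v)
    (h1 : ∀ a b, T a b → (∃ a' b', i a' = a ∧ i b' = b ∧ R a' b') ∨
      ∃ y y', v y = a ∧ v y' = b ∧ S y y')
    (h2 : ∀ y y', S y y' → Relation.ReflTransGen T (v y) (v y'))
    (h3 : ∀ x x' y y', i x = v y → i x' = v y' → Relation.ReflTransGen R x x' →
      Relation.ReflTransGen S y y') (y y' : Y) :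
    Relation.ReflTransGen T (v y) (v y') ↔ Relation.ReflTransGen S y y' := by
  constructor
  -- Invariant: the path read so far is an `S`-path to some `w`, possibly followed by a pending
  -- `R`-path inside `X`, which becomes an `S`-path when it meets a visible point again.
  · have key : ∀ z, Relation.ReflTransGen T (v y) z → ∃ w, Relation.ReflTransGen S y w ∧
        (z = v w ∨ ∃ a b, i a = v w ∧ i b = z ∧ Relation.ReflTransGen R a b) := by
      intro z hz
      induction hz with
      | refl => exact ⟨y, .refl, Or.inl rfl⟩
      | tail _ hT ih =>
        obtain ⟨w, hw, ih⟩ := ih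
        rcases h1 _ _ hT with ⟨a, b, rfl, rfl, hab⟩ | ⟨y1, y2, rfl, rfl, h12⟩
        · refine ⟨w, hw, Or.inr ?_⟩
          rcases ih with e | ⟨c, d, hc, hd, hcd⟩
          · exact ⟨a, b, e, rfl, .single hab⟩
          · rw [hi hd] at hcd
            exact ⟨c, b, hc, rfl, hcd.tail hab⟩
        · refine ⟨y2, ?_, Or.inl rfl⟩
          rcases ih with e | ⟨c, d, hc, hd, hcd⟩
          · rw [← hv e] at hw
            exact hw.tail h12
          · exact (hw.trans (h3 _ _ _ _ hc hd hcd)).tail h12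
    intro h
    obtain ⟨w, hw, e | ⟨a, b, ha, hb, hab⟩⟩ := key _ h
    · rwa [hv e]
    · exact hw.trans (h3 _ _ _ _ ha hb hab)
  · intro h
    induction h with
    | refl => exact .refl
    | tail _ h ih => exact ih.trans (h2 _ _ h)

theorem PreAug.isomorphic_of_common {A : Arena} {r s : PreAug A} {M : Type} (f : M ≃ r.Ev)
    (g : M ≃ s.Ev) (h1 : ∀ a b, s.sle (g a) (g b) ↔ r.sle (f a) (f b))
    (h2 : ∀ a b, s.le (g a) (g b) ↔ r.le (f a) (f b)) (h3 : ∀ a, s.disp (g a) = r.disp (f a)) :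
    r.Isomorphic s :=
  ⟨f.symm.trans g, fun a b => by simpa using h1 (f.symm a) (f.symm b),
    fun a b => by simpa using h2 (f.symm a) (f.symm b), fun a => by simpa using h3 (f.symm a)⟩

section Assoc

variable {A B C D : Arena}

/-- The composition of augmentations, as an augmentation. -/
def Aug.comp (hB : ∀ b, IsMinimal B.le b → B.pol b = .neg) (q : Aug (A.hom B))
    (p : Aug (B.hom C)) (φ : q.deseq.right.Symmetry p.deseq.left) : Aug (A.hom C) :=
  ⟨PreAug.comp q p φ, comp_isAug hB φ⟩

variable {q : Aug (A.hom B)} {p : Aug (B.hom C)} {u : Aug (C.hom D)}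
  (hB : ∀ b, IsMinimal B.le b → B.pol b = .neg) (hC : ∀ c, IsMinimal C.le c → C.pol c = .neg)
  (φ : q.deseq.right.Symmetry p.deseq.left) (ψ : p.deseq.right.Symmetry u.deseq.left)

/-- The left restriction of a composition. -/
def Aug.compLeft : q.deseq.left.Symmetry (Aug.comp hB q p φ).deseq.left :=
  Conf.homLeft q.deseq.left p.deseq.right

/-- The right restriction of a composition. -/
def Aug.compRight : p.deseq.right.Symmetry (Aug.comp hB q p φ).deseq.right :=
  Conf.homRight q.deseq.left p.deseq.right

/-- The steps of the interaction of three augmentations. -/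
def TernaryStep : q.Ev ⊕ (p.Ev ⊕ u.Ev) → q.Ev ⊕ (p.Ev ⊕ u.Ev) → Prop
  | .inl a, .inl b => q.le a b ∧ a ≠ b
  | .inr (.inl a), .inr (.inl b) => p.le a b ∧ a ≠ b
  | .inr (.inr a), .inr (.inr b) => u.le a b ∧ a ≠ b
  | .inl a, .inr (.inl b) => Link φ a b ∧ q.pol a = .pos
  | .inr (.inl b), .inl a => Link φ a b ∧ p.pol b = .pos
  | .inr (.inl a), .inr (.inr b) => Link ψ a b ∧ p.pol a = .pos
  | .inr (.inr b), .inr (.inl a) => Link ψ a b ∧ u.pol b = .pos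
  | _, _ => False

variable (q p u) in
/-- Inclusion of the external events into the interaction of three augmentations. -/
def ternaryVisible : q.deseq.left.Ev ⊕ u.deseq.right.Ev → q.Ev ⊕ (p.Ev ⊕ u.Ev) :=
  Sum.map (fun m => m.1) (fun m => .inr m.1)

theorem link_compRight (w : (Aug.comp hB q p φ).Ev) (c : u.Ev) :
    Link ((Aug.compRight hB φ).symm.trans ψ) w c ↔
      ∃ n : p.deseq.right.Ev, w = (.inr n : _ ⊕ _) ∧ Link ψ n.1 c := by
  constructor
  · rintro ⟨m, rfl, rfl⟩
    obtain ⟨n, rfl⟩ := (Aug.compRight hB φ).1.surjective m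
    refine ⟨n, rfl, n, rfl, ?_⟩
    exact congrArg (fun k => (ψ.1 k).1) ((Aug.compRight hB φ).symm_apply_apply n).symm
  · rintro ⟨n, rfl, m, h, rfl⟩
    rw [Subtype.ext h]
    refine ⟨(Aug.compRight hB φ).1 n, rfl, ?_⟩
    exact congrArg (fun k => (ψ.1 k).1) ((Aug.compRight hB φ).symm_apply_apply n)

theorem link_compLeft (a : q.Ev) (w : (Aug.comp hC p u ψ).Ev) :
    Link (φ.trans (Aug.compLeft hC ψ)) a w ↔
      ∃ n : p.deseq.left.Ev, w = (.inl n : _ ⊕ _) ∧ Link φ a n.1 := by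
  constructor
  · rintro ⟨m, rfl, rfl⟩
    exact ⟨φ.1 m, rfl, m, rfl, rfl⟩
  · rintro ⟨n, rfl, m, rfl, h⟩
    rw [← Subtype.ext h]
    exact ⟨m, rfl, rfl⟩

/-- The interaction of `q` and `p` is the part contracted by `reflTransGen_hide`: every remaining
step involves `u`, and synchronisations with `u` meet only events of `p` displayed to `C`, which
stay visible in the composite. -/
theorem ternary_assoc_left (m n : q.deseq.left.Ev ⊕ u.deseq.right.Ev) :
    Relation.ReflTransGen (TernaryStep φ ψ) (ternaryVisible q p u m) (ternaryVisible q p u n) ↔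
      (PreAug.comp (Aug.comp hB q p φ) u ((Aug.compRight hB φ).symm.trans ψ)).le
        (Sum.map (Aug.compLeft hB φ).1 _root_.id m) (Sum.map (Aug.compLeft hB φ).1 _root_.id n) := by
  let i : q.Ev ⊕ p.Ev → q.Ev ⊕ (p.Ev ⊕ u.Ev) := Sum.map _root_.id .inl
  let v : (Aug.comp hB q p φ).Ev ⊕ u.Ev → q.Ev ⊕ (p.Ev ⊕ u.Ev) :=
    Sum.elim (fun w => i (visible q p w)) (fun c => .inr (.inr c))
  have hi : Function.Injective i := Sum.map_injective.2 ⟨fun _ _ h => h, Sum.inl_injective⟩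
  have hv : Function.Injective v := by
    refine Function.Injective.sumElim (hi.comp (visible_injective q p))
      (Sum.inr_injective.comp Sum.inr_injective) ?_
    rintro (a | a) c h <;> cases h
  have hstep : ∀ a b, InterStep q p φ a b → TernaryStep φ ψ (i a) (i b) := by
    rintro (a | a) (b | b) h
    · exact interStep_inl_inl.1 h
    · exact interStep_inl_inr.1 h
    · exact interStep_inr_inl.1 h
    · exact interStep_inr_inr.1 h
  have hpol : ∀ k : p.deseq.right.Ev,
      (Aug.comp hB q p φ).pol (.inr k : _ ⊕ _) = p.pol k.1 := fun k => comp_pol φ (.inr k)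
  have key := reflTransGen_hide (R := InterStep q p φ) (T := TernaryStep φ ψ)
    (S := InterStep (Aug.comp hB q p φ) u ((Aug.compRight hB φ).symm.trans ψ)) hi hv ?_ ?_ ?_
    (visible (Aug.comp hB q p φ) u (Sum.map (Aug.compLeft hB φ).1 _root_.id m))
    (visible (Aug.comp hB q p φ) u (Sum.map (Aug.compLeft hB φ).1 _root_.id n))
  · refine Iff.trans ?_ key
    rcases m with m | m <;> rcases n with n | n <;> exact Iff.rfl
  · rintro (a | a | a) (b | b | b) h
    · exact Or.inl ⟨.inl a, .inl b, rfl, rfl, interStep_inl_inl.2 h⟩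
    · exact Or.inl ⟨.inl a, .inr b, rfl, rfl, interStep_inl_inr.2 h⟩
    · exact h.elim
    · exact Or.inl ⟨.inr a, .inl b, rfl, rfl, interStep_inr_inl.2 h⟩
    · exact Or.inl ⟨.inr a, .inr b, rfl, rfl, interStep_inr_inr.2 h⟩
    · obtain ⟨⟨k, rfl, hk⟩, hp⟩ := h
      refine Or.inr ⟨.inl (.inr k : _ ⊕ _), .inr b, rfl, rfl, interStep_inl_inr.2 ⟨?_, ?_⟩⟩
      · exact (link_compRight hB φ ψ _ _).2 ⟨k, rfl, k, rfl, hk⟩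
      · rw [hpol, hp]
    · exact h.elim
    · obtain ⟨⟨k, rfl, hk⟩, hp⟩ := h
      refine Or.inr ⟨.inr a, .inl (.inr k : _ ⊕ _), rfl, rfl, interStep_inr_inl.2 ⟨?_, hp⟩⟩
      exact (link_compRight hB φ ψ _ _).2 ⟨k, rfl, k, rfl, hk⟩
    · exact Or.inr ⟨.inr a, .inr b, rfl, rfl, interStep_inr_inr.2 h⟩
  · rintro (w | a) (w' | b) h
    · rw [interStep_inl_inl] at h
      exact Relation.ReflTransGen.lift i hstep _ _ h.1
    · obtain ⟨hl, hp⟩ := interStep_inl_inr.1 h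
      obtain ⟨k, rfl, hk⟩ := (link_compRight hB φ ψ _ _).1 hl
      rw [hpol] at hp
      exact .single ⟨hk, hp⟩
    · obtain ⟨hl, hp⟩ := interStep_inr_inl.1 h
      obtain ⟨k, rfl, hk⟩ := (link_compRight hB φ ψ _ _).1 hl
      exact .single ⟨hk, hp⟩
    · exact .single (interStep_inr_inr.1 h)
  · rintro x x' (w | c) (w' | c') e e' h
    · rw [hi e, hi e'] at h
      exact interLe_inl (q := Aug.comp hB q p φ) h
    · rcases x' with x' | x' <;> cases e'
    · rcases x with x | x <;> cases e
    · rcases x with x | x <;> cases e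

theorem ternary_assoc_right (m n : q.deseq.left.Ev ⊕ u.deseq.right.Ev) :
    Relation.ReflTransGen (TernaryStep φ ψ) (ternaryVisible q p u m) (ternaryVisible q p u n) ↔
      (PreAug.comp q (Aug.comp hC p u ψ) (φ.trans (Aug.compLeft hC ψ))).le
        (Sum.map _root_.id (Aug.compRight hC ψ).1 m)
        (Sum.map _root_.id (Aug.compRight hC ψ).1 n) := by
  let v : q.Ev ⊕ (Aug.comp hC p u ψ).Ev → q.Ev ⊕ (p.Ev ⊕ u.Ev) :=
    Sum.map _root_.id (visible p u)
  have hi : Function.Injective (Sum.inr : p.Ev ⊕ u.Ev → q.Ev ⊕ (p.Ev ⊕ u.Ev)) :=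
    Sum.inr_injective
  have hv : Function.Injective v :=
    Sum.map_injective.2 ⟨fun _ _ h => h, visible_injective p u⟩
  have hstep : ∀ a b, InterStep p u ψ a b → TernaryStep φ ψ (.inr a) (.inr b) := by
    rintro (a | a) (b | b) h
    · exact interStep_inl_inl.1 h
    · exact interStep_inl_inr.1 h
    · exact interStep_inr_inl.1 h
    · exact interStep_inr_inr.1 h
  have hpol : ∀ k : p.deseq.left.Ev,
      (Aug.comp hC p u ψ).pol (.inl k : _ ⊕ _) = p.pol k.1 := fun k => comp_pol ψ (.inl k)
  have key := reflTransGen_hide (R := InterStep p u ψ) (T := TernaryStep φ ψ)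
    (S := InterStep q (Aug.comp hC p u ψ) (φ.trans (Aug.compLeft hC ψ))) hi hv ?_ ?_ ?_
    (visible q (Aug.comp hC p u ψ) (Sum.map _root_.id (Aug.compRight hC ψ).1 m))
    (visible q (Aug.comp hC p u ψ) (Sum.map _root_.id (Aug.compRight hC ψ).1 n))
  · refine Iff.trans ?_ key
    rcases m with m | m <;> rcases n with n | n <;> exact Iff.rfl
  · rintro (a | a | a) (b | b | b) h
    · exact Or.inr ⟨.inl a, .inl b, rfl, rfl, interStep_inl_inl.2 h⟩
    · obtain ⟨⟨k, rfl, rfl⟩, hp⟩ := h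
      refine Or.inr ⟨.inl k.1, .inr (.inl (φ.1 k) : _ ⊕ _), rfl, rfl,
        interStep_inl_inr.2 ⟨?_, hp⟩⟩
      exact (link_compLeft hC φ ψ _ _).2 ⟨φ.1 k, rfl, k, rfl, rfl⟩
    · exact h.elim
    · obtain ⟨⟨k, rfl, rfl⟩, hp⟩ := h
      refine Or.inr ⟨.inr (.inl (φ.1 k) : _ ⊕ _), .inl k.1, rfl, rfl,
        interStep_inr_inl.2 ⟨?_, ?_⟩⟩
      · exact (link_compLeft hC φ ψ _ _).2 ⟨φ.1 k, rfl, k, rfl, rfl⟩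
      · rw [hpol, hp]
    · exact Or.inl ⟨.inl a, .inl b, rfl, rfl, interStep_inl_inl.2 h⟩
    · exact Or.inl ⟨.inl a, .inr b, rfl, rfl, interStep_inl_inr.2 h⟩
    · exact h.elim
    · exact Or.inl ⟨.inr a, .inl b, rfl, rfl, interStep_inr_inl.2 h⟩
    · exact Or.inl ⟨.inr a, .inr b, rfl, rfl, interStep_inr_inr.2 h⟩
  · rintro (a | w) (b | w') h
    · exact .single (interStep_inl_inl.1 h)
    · obtain ⟨hl, hp⟩ := interStep_inl_inr.1 h
      obtain ⟨k, rfl, hk⟩ := (link_compLeft hC φ ψ _ _).1 hl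
      exact .single ⟨hk, hp⟩
    · obtain ⟨hl, hp⟩ := interStep_inr_inl.1 h
      obtain ⟨k, rfl, hk⟩ := (link_compLeft hC φ ψ _ _).1 hl
      rw [hpol] at hp
      exact .single ⟨hk, hp⟩
    · rw [interStep_inr_inr] at h
      exact Relation.ReflTransGen.lift _ hstep _ _ h.1
  · rintro x x' (c | w) (c' | w') e e' h
    · cases e
    · cases e
    · cases e'
    · rw [hi e, hi e'] at h
      exact interLe_inr (p := Aug.comp hC p u ψ) h

/-- Both sides carry the order of the ternary interaction restricted to the events displayed to `A`
and `D`. -/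
theorem comp_assoc :
    (PreAug.comp (Aug.comp hB q p φ) u ((Aug.compRight hB φ).symm.trans ψ)).Isomorphic
      (PreAug.comp q (Aug.comp hC p u ψ) (φ.trans (Aug.compLeft hC ψ))) := by
  let f : q.deseq.left.Ev ⊕ u.deseq.right.Ev ≃
      (Aug.comp hB q p φ).deseq.left.Ev ⊕ u.deseq.right.Ev :=
    Equiv.sumCongr (Aug.compLeft hB φ).1.toEquiv (Equiv.refl _)
  let g : q.deseq.left.Ev ⊕ u.deseq.right.Ev ≃
      q.deseq.left.Ev ⊕ (Aug.comp hC p u ψ).deseq.right.Ev :=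
    Equiv.sumCongr (Equiv.refl _) (Aug.compRight hC ψ).1.toEquiv
  refine PreAug.isomorphic_of_common f g ?_ (fun a b => ?_) ?_
  · rintro (a | a) (b | b)
    · exact (comp_sle_inl_inl _ a b).trans
        (((Aug.compLeft hB φ).1.map_rel_iff (a := a) (b := b)).symm.trans
          (comp_sle_inl_inl ((Aug.compRight hB φ).symm.trans ψ) ((Aug.compLeft hB φ).1 a)
            ((Aug.compLeft hB φ).1 b)).symm)
    · exact iff_of_false (not_comp_sle_inl_inr _ _ _) (not_comp_sle_inl_inr _ _ _)
    · exact iff_of_false (not_comp_sle_inr_inl _ _ _) (not_comp_sle_inr_inl _ _ _)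
    · exact (comp_sle_inr_inr _ _ _).trans
        (((Aug.compRight hC ψ).1.map_rel_iff (a := a) (b := b)).trans
          (comp_sle_inr_inr _ a b).symm)
  · exact (ternary_assoc_right hC φ ψ a b).symm.trans (ternary_assoc_left hB φ ψ a b)
  · rintro (a | a)
    · exact congrArg Sum.inl ((Aug.compLeft hB φ).2 a).symm
    · exact congrArg Sum.inr ((Aug.compRight hC ψ).2 a)

end Assoc

/-! ### Unit laws -/

section Unit

variable {A B : Arena}

/-- The copycat augmentation. -/
def Aug.copycat (x : Conf A) : Aug (A.hom A) := ⟨PreAug.copycat x, copycat_isAug x⟩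

/-- The events of an augmentation on `A ⊢ B` are displayed either to `A` or to `B`. -/
noncomputable def Aug.split (p : Aug (A.hom B)) :
    p.deseq.left.Ev ⊕ p.deseq.right.Ev ≃ p.Ev :=
  Equiv.ofBijective (Sum.elim (fun m => m.1) (fun m => m.1)) (by
    constructor
    · refine Function.Injective.sumElim Subtype.val_injective Subtype.val_injective ?_
      rintro m n h
      exact Sum.not_isRight.2 m.2 (h ▸ n.2)
    · intro m
      by_cases h : Sum.isLeft (p.disp m) = true
      · exact ⟨.inl ⟨m, h⟩, rfl⟩
      · exact ⟨.inr ⟨m, Sum.not_isLeft.1 h⟩, rfl⟩)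

theorem Aug.sle_split (p : Aug (A.hom B)) (a b : p.deseq.left.Ev ⊕ p.deseq.right.Ev) :
    p.sle (p.split a) (p.split b) ↔ Sum.LiftRel p.deseq.left.le p.deseq.right.le a b := by
  rcases a with a | a <;> rcases b with b | b
  · exact (Sum.liftRel_inl_inl (r := p.deseq.left.le)).symm
  · refine iff_of_false (fun h => ?_) Sum.not_liftRel_inl_inr
    exact Sum.not_isLeft.2 b.2 ((p.isLeft_iff_of_sle h).1 a.2)
  · refine iff_of_false (fun h => ?_) Sum.not_liftRel_inr_inl
    exact Sum.not_isRight.2 b.2 ((p.isRight_iff_of_sle h).1 a.2)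
  · exact (Sum.liftRel_inr_inr (s := p.deseq.right.le)).symm

theorem Aug.disp_split (p : Aug (A.hom B)) (a : p.deseq.left.Ev ⊕ p.deseq.right.Ev) :
    p.disp (p.split a) = Sum.map p.deseq.left.disp p.deseq.right.disp a := by
  rcases a with a | a
  · exact p.disp_left a
  · exact p.disp_right a

/-- Replacing the events of a part of an augmentation by copies, which come after positive events
and before negative ones, preserves the causal order. -/
theorem Aug.le_copy (p : Aug A) {M Z : Type} {L : Z → Z → Prop}
    (hL : ∀ {a b c}, L a b → L b c → L a c) (hL' : ∀ a, L a a)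
    (g : M ≃ p.Ev) (o c : M → Z) (hid : M → Prop)
    (h1 : ∀ m n, p.le (g m) (g n) → L (o m) (o n))
    (h2 : ∀ n, (hid n → p.pol (g n) = .neg) → L (c n) (o n))
    (h3 : ∀ n, (hid n → p.pol (g n) = .pos) → L (o n) (c n))
    (h4 : ∀ m n, hid m → p.sle (g m) (g n) → L (c m) (c n))
    (h5 : ∀ m n, p.sle (g m) (g n) → (hid m ↔ hid n)) (m n : M) (h : p.le (g m) (g n)) :
    L (c m) (c n) := by
  -- Targets with a link from original to copy come first. If the source is hidden and positive, its
  -- copy has no link back to it. The path then runs along copies to the immediate successor `k`,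
  -- static by courtesy and negative, and returns to the originals there.
  have pos : ∀ m n, p.le (g m) (g n) → (hid n → p.pol (g n) = .pos) → L (c m) (c n) := by
    intro m n h hn
    by_cases hm : hid m → p.pol (g m) = .neg
    · exact hL (h2 m hm) (hL (h1 m n h) (h3 n hn))
    · rw [Classical.not_imp] at hm
      obtain ⟨hm, hmp⟩ := hm
      replace hmp := Polarity.ne_neg_iff.1 hmp
      by_cases e : g m = g n
      · rw [g.injective e]
        exact hL' _
      · obtain ⟨k, hk, hkn⟩ := p.isAug.forest.exists_imm_above h e
        obtain ⟨k, rfl⟩ := g.surjective k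
        have hs := p.isAug.courteous _ _ hk (Or.inl hmp)
        have hkp := p.alternating hs
        rw [hmp, ne_comm, Polarity.ne_pos_iff] at hkp
        exact hL (h4 m k hm hs.1) (hL (h2 k fun _ => hkp) (hL (h1 k n hkn) (h3 n hn)))
  by_cases hn : hid n → p.pol (g n) = .pos
  · exact pos m n h hn
  · rw [Classical.not_imp] at hn
    obtain ⟨hn, hnp⟩ := hn
    replace hnp := Polarity.ne_pos_iff.1 hnp
    by_cases e : g m = g n
    · rw [g.injective e]
      exact hL' _
    · obtain ⟨k, hmk, hk⟩ := p.isAug.forest.exists_imm_below h e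
      obtain ⟨k, rfl⟩ := g.surjective k
      have hs := p.isAug.courteous _ _ hk (Or.inr hnp)
      have hkp := p.alternating hs
      rw [hnp, Polarity.ne_neg_iff] at hkp
      exact hL (pos m k hmk fun _ => hkp) (h4 k n ((h5 k n hs.1).2 hn) hs.1)

theorem le_of_interLe {q : Aug (A.hom B)} {C : Arena} {p : Aug (B.hom C)}
    {φ : q.deseq.right.Symmetry p.deseq.left} {D : Arena} (r : Aug D) (f : q.Ev ⊕ p.Ev → r.Ev)
    (hf : ∀ a b, InterStep q p φ a b → r.le (f a) (f b)) {a b : q.Ev ⊕ p.Ev}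
    (h : interLe q p φ a b) : r.le (f a) (f b) := by
  induction h with
  | refl => exact r.isAug.forest.refl _
  | tail _ h ih => exact r.isAug.forest.trans _ _ _ ih (hf _ _ h)

theorem copycat_le_swap_inl {x : Conf A} {k : x.Ev} (h : A.pol (x.disp k) = .pos) :
    (PreAug.copycat x).le (.inl k : _ ⊕ _) (.inr k : _ ⊕ _) :=
  .single (.pos k k (x.isConf.forest.refl k) h)

theorem copycat_le_swap_inr {x : Conf A} {k : x.Ev} (h : A.pol (x.disp k) = .neg) :
    (PreAug.copycat x).le (.inr k : _ ⊕ _) (.inl k : _ ⊕ _) :=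
  .single (.neg k k (x.isConf.forest.refl k) h)

/-- From `p` to the composite, `le_copy` exchanges the events on `A` for their copies in the left
component of copycat. Conversely, collapsing both components of copycat onto `p` sends each step of
the interaction to an inequality of `p`. -/
theorem comp_copycat_left (x : Conf A) (p : Aug (A.hom B))
    (φ : (Aug.copycat x).deseq.right.Symmetry p.deseq.left) :
    (PreAug.comp (Aug.copycat x) p φ).Isomorphic p.toPreAug := by
  let α : x.Symmetry p.deseq.left := (Conf.homRight x x).trans φ
  have hlink : ∀ (w : x.Ev ⊕ x.Ev) n, Link φ w n ↔ ∃ k, w = .inr k ∧ (α.1 k).1 = n := by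
    intro w n
    constructor
    · rintro ⟨m, rfl, rfl⟩
      obtain ⟨k, rfl⟩ := (Conf.homRight x x).1.surjective m
      exact ⟨k, rfl, rfl⟩
    · rintro ⟨k, rfl, rfl⟩
      exact ⟨(Conf.homRight x x).1 k, rfl, rfl⟩
  let f : x.Ev ⊕ p.deseq.right.Ev ≃ (Aug.copycat x).deseq.left.Ev ⊕ p.deseq.right.Ev :=
    Equiv.sumCongr (Conf.homLeft x x).1.toEquiv (Equiv.refl _)
  let g : x.Ev ⊕ p.deseq.right.Ev ≃ p.Ev :=
    (Equiv.sumCongr α.1.toEquiv (Equiv.refl _)).trans p.split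
  have hpol : ∀ k, p.pol (α.1 k).1 = (A.pol (x.disp k)).flip := fun k => by
    rw [p.pol_left, α.2]
  have hsle : ∀ a b, p.sle (g a) (g b) ↔ Sum.LiftRel x.le p.deseq.right.le a b := by
    intro a b
    refine (p.sle_split _ _).trans ?_
    rcases a with a | a <;> rcases b with b | b
    · exact Sum.liftRel_inl_inl.trans (α.1.map_rel_iff.trans Sum.liftRel_inl_inl.symm)
    · exact iff_of_false Sum.not_liftRel_inl_inr Sum.not_liftRel_inl_inr
    · exact iff_of_false Sum.not_liftRel_inr_inl Sum.not_liftRel_inr_inl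
    · exact Sum.liftRel_inr_inr.trans Sum.liftRel_inr_inr.symm
  refine PreAug.isomorphic_of_common f g (fun a b => (hsle a b).trans ?_) (fun a b => ⟨?_, ?_⟩) ?_
  · rcases a with a | a <;> rcases b with b | b
    · refine Sum.liftRel_inl_inl.trans (.trans ?_ (comp_sle_inl_inl φ _ _).symm)
      exact (Sum.liftRel_inl_inl (s := x.le)).symm
    · exact iff_of_false Sum.not_liftRel_inl_inr Sum.not_liftRel_inl_inr
    · exact iff_of_false Sum.not_liftRel_inr_inl Sum.not_liftRel_inr_inl
    · exact Sum.liftRel_inr_inr.trans (comp_sle_inr_inr φ a b).symm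
  · refine p.le_copy (L := interLe (Aug.copycat x) p φ) Relation.ReflTransGen.trans
      (fun _ => .refl) g (fun m => .inr (g m)) (fun m => visible (Aug.copycat x) p (f m))
      (fun m => m.isLeft = true) (fun m n h => interLe_inr h) ?_ ?_ ?_ ?_ a b
    · rintro (k | k) hk
      · have hp := hk rfl
        replace hp : A.pol (x.disp k) = .pos := Polarity.flip_eq_neg_iff.1 ((hpol k).symm.trans hp)
        exact (interLe_inl (q := Aug.copycat x) (copycat_le_swap_inl hp)).tail
          (interStep_inl_inr.2 ⟨(hlink _ _).2 ⟨k, rfl, rfl⟩, hp⟩)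
      · exact .refl
    · rintro (k | k) hk
      · have hp := hk rfl
        have hp' : A.pol (x.disp k) = .neg := Polarity.flip_eq_pos_iff.1 ((hpol k).symm.trans hp)
        exact .head (interStep_inr_inl.2 ⟨(hlink _ _).2 ⟨k, rfl, rfl⟩, hp⟩)
          (interLe_inl (q := Aug.copycat x) (copycat_le_swap_inr hp'))
      · exact .refl
    · rintro (m | m) (n | n) hm h
      · have h' := Sum.liftRel_inl_inl.1 ((hsle _ _).1 h)
        exact interLe_inl (q := Aug.copycat x) (.single (.inl m n h'))
      · exact absurd ((hsle _ _).1 h) Sum.not_liftRel_inl_inr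
      · cases hm
      · cases hm
    · rintro m n h
      rcases (hsle _ _).1 h with h | h <;> simp
  · intro h
    have key := le_of_interLe (φ := φ) p
      (Sum.elim (fun w => (α.1 (copyBase x w)).1) _root_.id) ?_ h
    · rcases a with a | a <;> rcases b with b | b <;> exact key
    · rintro (w | n) (w' | n') h
      · refine p.isAug.ruleAbiding _ _ ?_
        exact α.1.map_rel_iff.2 ((copycat_le_iff w w').1 (interStep_inl_inl.1 h).1).1
      · obtain ⟨k, rfl, rfl⟩ := (hlink _ _).1 (interStep_inl_inr.1 h).1
        exact p.isAug.forest.refl _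
      · obtain ⟨k, rfl, rfl⟩ := (hlink _ _).1 (interStep_inr_inl.1 h).1
        exact p.isAug.forest.refl _
      · exact (interStep_inr_inr.1 h).1
  · intro a
    refine (p.disp_split _).trans ?_
    rcases a with a | a
    · exact congrArg Sum.inl (α.2 a)
    · rfl

theorem comp_copycat_right (x : Conf B) (q : Aug (A.hom B))
    (φ : q.deseq.right.Symmetry (Aug.copycat x).deseq.left) :
    (PreAug.comp q (Aug.copycat x) φ).Isomorphic q.toPreAug := by
  let α : x.Symmetry q.deseq.right := (Conf.homLeft x x).trans φ.symm
  have hlink : ∀ n (w : x.Ev ⊕ x.Ev), Link φ n w ↔ ∃ k, w = .inl k ∧ (α.1 k).1 = n := by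
    intro n w
    constructor
    · rintro ⟨m, rfl, rfl⟩
      obtain ⟨k, hk⟩ := (Conf.homLeft x x).1.surjective (φ.1 m)
      refine ⟨k, congrArg Subtype.val hk.symm, congrArg Subtype.val ?_⟩
      exact (congrArg φ.1.symm hk).trans (φ.symm_apply_apply m)
    · rintro ⟨k, rfl, rfl⟩
      exact ⟨α.1 k, rfl, congrArg Subtype.val (φ.apply_symm_apply ((Conf.homLeft x x).1 k))⟩
  let f : q.deseq.left.Ev ⊕ x.Ev ≃ q.deseq.left.Ev ⊕ (Aug.copycat x).deseq.right.Ev :=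
    Equiv.sumCongr (Equiv.refl _) (Conf.homRight x x).1.toEquiv
  let g : q.deseq.left.Ev ⊕ x.Ev ≃ q.Ev :=
    (Equiv.sumCongr (Equiv.refl _) α.1.toEquiv).trans q.split
  have hpol : ∀ k, q.pol (α.1 k).1 = B.pol (x.disp k) := fun k => by
    rw [q.pol_right, α.2]
  have hsle : ∀ a b, q.sle (g a) (g b) ↔ Sum.LiftRel q.deseq.left.le x.le a b := by
    intro a b
    refine (q.sle_split _ _).trans ?_
    rcases a with a | a <;> rcases b with b | b
    · exact Sum.liftRel_inl_inl.trans Sum.liftRel_inl_inl.symm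
    · exact iff_of_false Sum.not_liftRel_inl_inr Sum.not_liftRel_inl_inr
    · exact iff_of_false Sum.not_liftRel_inr_inl Sum.not_liftRel_inr_inl
    · exact Sum.liftRel_inr_inr.trans (α.1.map_rel_iff.trans Sum.liftRel_inr_inr.symm)
  refine PreAug.isomorphic_of_common f g (fun a b => (hsle a b).trans ?_) (fun a b => ⟨?_, ?_⟩) ?_
  · rcases a with a | a <;> rcases b with b | b
    · exact Sum.liftRel_inl_inl.trans (comp_sle_inl_inl φ a b).symm
    · exact iff_of_false Sum.not_liftRel_inl_inr Sum.not_liftRel_inl_inr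
    · exact iff_of_false Sum.not_liftRel_inr_inl Sum.not_liftRel_inr_inl
    · refine Sum.liftRel_inr_inr.trans (.trans ?_ (comp_sle_inr_inr φ _ _).symm)
      exact (Sum.liftRel_inr_inr (r := x.le)).symm
  · refine q.le_copy (L := interLe q (Aug.copycat x) φ) Relation.ReflTransGen.trans
      (fun _ => .refl) g (fun m => .inl (g m)) (fun m => visible q (Aug.copycat x) (f m))
      (fun m => m.isRight = true) (fun m n h => interLe_inl h) ?_ ?_ ?_ ?_ a b
    · rintro (k | k) hk
      · exact .refl
      · have hp := hk rfl
        replace hp : B.pol (x.disp k) = .neg := (hpol k).symm.trans hp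
        exact (interLe_inr (p := Aug.copycat x) (copycat_le_swap_inr hp)).tail
          (interStep_inr_inl.2 ⟨(hlink _ _).2 ⟨k, rfl, rfl⟩, Polarity.flip_eq_pos_iff.2 hp⟩)
    · rintro (k | k) hk
      · exact .refl
      · have hp := hk rfl
        have hp' : B.pol (x.disp k) = .pos := (hpol k).symm.trans hp
        exact .head (interStep_inl_inr.2 ⟨(hlink _ _).2 ⟨k, rfl, rfl⟩, hp⟩)
          (interLe_inr (p := Aug.copycat x) (copycat_le_swap_inl hp'))
    · rintro (m | m) (n | n) hm h
      · cases hm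
      · cases hm
      · exact absurd ((hsle _ _).1 h) Sum.not_liftRel_inr_inl
      · have h' := Sum.liftRel_inr_inr.1 ((hsle _ _).1 h)
        exact interLe_inr (p := Aug.copycat x) (.single (.inr m n h'))
    · rintro m n h
      rcases (hsle _ _).1 h with h | h <;> simp
  · intro h
    have key := le_of_interLe (φ := φ) q
      (Sum.elim _root_.id (fun w => (α.1 (copyBase x w)).1)) ?_ h
    · rcases a with a | a <;> rcases b with b | b <;> exact key
    · rintro (n | w) (n' | w') h
      · exact (interStep_inl_inl.1 h).1
      · obtain ⟨k, rfl, rfl⟩ := (hlink _ _).1 (interStep_inl_inr.1 h).1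
        exact q.isAug.forest.refl _
      · obtain ⟨k, rfl, rfl⟩ := (hlink _ _).1 (interStep_inr_inl.1 h).1
        exact q.isAug.forest.refl _
      · refine q.isAug.ruleAbiding _ _ ?_
        exact α.1.map_rel_iff.2 ((copycat_le_iff w w').1 (interStep_inr_inr.1 h).1).1
  · intro a
    refine (q.disp_split _).trans ?_
    rcases a with a | a
    · rfl
    · exact congrArg Sum.inr (α.2 a)

end Unit

/-! ### Strategies -/

/-- The isomorphism class of an augmentation. -/
def Aug.isog {A : Arena} (q : Aug A) : Isog A := Quotient.mk _ q

theorem Aug.isog_eq_iff {A : Arena} {q p : Aug A} :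
    q.isog = p.isog ↔ q.toPreAug.Isomorphic p.toPreAug :=
  Quotient.eq (r := Aug.setoid A)

theorem Isog.isog_rep {A : Arena} (r : Isog A) : r.rep.isog = r := Quotient.out_eq r

theorem Aug.isomorphic_rep_iff {A : Arena} (q : Aug A) (r : Isog A) :
    q.toPreAug.Isomorphic r.rep.toPreAug ↔ q.isog = r := by
  rw [← Aug.isog_eq_iff, r.isog_rep]

/-! ### Counting symmetries, and associativity for strategies -/

section Weight

variable {A B C D : Arena}

open Classical in
/-- The number of symmetries along which `q` and `p` compose to `r`. -/
noncomputable def weight (q : Aug (A.hom B)) (p : Aug (B.hom C)) (r : Isog (A.hom C)) : ENNReal :=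
  ∑' φ : q.deseq.right.Symmetry p.deseq.left,
    if (PreAug.comp q p φ).Isomorphic r.rep.toPreAug then 1 else 0

theorem comp_apply (σ : Strategy (A.hom B)) (τ : Strategy (B.hom C)) (r : Isog (A.hom C)) :
    Strategy.comp σ τ r = ∑' (q : Isog (A.hom B)) (p : Isog (B.hom C)),
      σ q * τ p * weight q.rep p.rep r := by
  simp only [Strategy.comp, weight, ← ENNReal.tsum_mul_left, mul_ite, mul_one, mul_zero]

open Classical in
theorem weight_eq (hB : ∀ b, IsMinimal B.le b → B.pol b = .neg) (q : Aug (A.hom B))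
    (p : Aug (B.hom C)) (r : Isog (A.hom C)) :
    weight q p r = ∑' φ : q.deseq.right.Symmetry p.deseq.left,
      if (Aug.comp hB q p φ).isog = r then 1 else 0 := by
  simp only [← Aug.isomorphic_rep_iff]
  rfl

/-- This allows a chosen representative to be replaced by a concrete composite or copycat. -/
theorem weight_congr (hB : ∀ b, IsMinimal B.le b → B.pol b = .neg) {q q' : Aug (A.hom B)}
    {p p' : Aug (B.hom C)} (hq : q.toPreAug.Isomorphic q'.toPreAug)
    (hp : p.toPreAug.Isomorphic p'.toPreAug) (r : Isog (A.hom C)) :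
    weight q p r = weight q' p' r := by
  obtain ⟨χ, hχ⟩ := exists_symmetry_equiv hq hp
  rw [weight_eq hB, weight_eq hB, ← χ.tsum_eq]
  refine tsum_congr fun φ => ?_
  have : (Aug.comp hB q p φ).isog = (Aug.comp hB q' p' (χ φ)).isog := Aug.isog_eq_iff.2 (hχ φ)
  rw [this]

theorem isomorphic_refl {A : Arena} (q : Aug A) : q.toPreAug.Isomorphic q.toPreAug :=
  (Aug.setoid A).refl q

theorem isomorphic_rep_isog {A : Arena} (q : Aug A) :
    q.isog.rep.toPreAug.Isomorphic q.toPreAug :=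
  Aug.isog_eq_iff.1 (Isog.isog_rep _)

/-- Each symmetry contributes to the weight of exactly one class, that of the corresponding
composite. -/
theorem tsum_weight_mul (hB : ∀ b, IsMinimal B.le b → B.pol b = .neg) (q : Aug (A.hom B))
    (p : Aug (B.hom C)) (F : Isog (A.hom C) → ENNReal) :
    ∑' s, weight q p s * F s = ∑' φ, F (Aug.comp hB q p φ).isog := by
  classical
  simp only [weight_eq hB, ← ENNReal.tsum_mul_right]
  rw [ENNReal.tsum_comm]
  refine tsum_congr fun φ => ?_
  rw [tsum_eq_single (Aug.comp hB q p φ).isog]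
  · simp
  · intro s hs
    rw [if_neg hs.symm, zero_mul]

/-- Both sides count the pairs `(φ, ψ)` whose triple composition is `r`, and `comp_assoc` matches
them pair by pair. -/
theorem weight_assoc (hB : ∀ b, IsMinimal B.le b → B.pol b = .neg)
    (hC : ∀ c, IsMinimal C.le c → C.pol c = .neg) (q : Aug (A.hom B)) (p : Aug (B.hom C))
    (u : Aug (C.hom D)) (r : Isog (A.hom D)) :
    ∑' s, weight q p s * weight s.rep u r = ∑' t, weight p u t * weight q t.rep r := by
  classical
  rw [tsum_weight_mul hB, tsum_weight_mul hC]
  have hl : ∀ φ, weight (Aug.comp hB q p φ).isog.rep u r =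
      ∑' ψ : p.deseq.right.Symmetry u.deseq.left,
        if (Aug.comp hC (Aug.comp hB q p φ) u ((Aug.compRight hB φ).symm.trans ψ)).isog = r
          then 1 else 0 := by
    intro φ
    rw [weight_congr hC (isomorphic_rep_isog _) (isomorphic_refl u), weight_eq hC]
    -- The part of the composite displayed to `C` is that of `p`, so the sum is reindexed by
    -- symmetries from `p` to `u`.
    exact ((Conf.Symmetry.congr (Aug.compRight hB φ) (Conf.Symmetry.refl _)).tsum_eq _).symm
  have hr : ∀ ψ, weight q (Aug.comp hC p u ψ).isog.rep r =
      ∑' φ : q.deseq.right.Symmetry p.deseq.left,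
        if (Aug.comp hB q (Aug.comp hC p u ψ) (φ.trans (Aug.compLeft hC ψ))).isog = r
          then 1 else 0 := by
    intro ψ
    rw [weight_congr hB (isomorphic_refl q) (isomorphic_rep_isog _), weight_eq hB]
    exact ((Conf.Symmetry.congr (Conf.Symmetry.refl _) (Aug.compLeft hC ψ)).tsum_eq _).symm
  simp only [hl, hr]
  rw [ENNReal.tsum_comm]
  refine tsum_congr fun ψ => tsum_congr fun φ => ?_
  have : (Aug.comp hC (Aug.comp hB q p φ) u ((Aug.compRight hB φ).symm.trans ψ)).isog =
      (Aug.comp hB q (Aug.comp hC p u ψ) (φ.trans (Aug.compLeft hC ψ))).isog :=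
    Aug.isog_eq_iff.2 (comp_assoc hB hC φ ψ)
  rw [this]

theorem strategy_assoc (hB : ∀ b, IsMinimal B.le b → B.pol b = .neg)
    (hC : ∀ c, IsMinimal C.le c → C.pol c = .neg) (σ : Strategy (A.hom B))
    (τ : Strategy (B.hom C)) (υ : Strategy (C.hom D)) :
    Strategy.comp (Strategy.comp σ τ) υ = Strategy.comp σ (Strategy.comp τ υ) := by
  funext r
  have hl : Strategy.comp (Strategy.comp σ τ) υ r =
      ∑' (q : Isog (A.hom B)) (p : Isog (B.hom C)) (u : Isog (C.hom D)),
        σ q * τ p * υ u * ∑' s, weight q.rep p.rep s * weight s.rep u.rep r := by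
    simp only [comp_apply, ← ENNReal.tsum_mul_right, ← ENNReal.tsum_mul_left]
    rw [ENNReal.tsum_comm]
    calc _ = ∑' (u : Isog (C.hom D)) (q : Isog (A.hom B)) (p : Isog (B.hom C)) (s : Isog (A.hom C)),
          σ q * τ p * weight q.rep p.rep s * υ u * weight s.rep u.rep r := by
          refine tsum_congr fun u => ?_
          rw [ENNReal.tsum_comm]
          exact tsum_congr fun q => ENNReal.tsum_comm
      _ = _ := by
          rw [ENNReal.tsum_comm]
          refine tsum_congr fun q => ?_
          rw [ENNReal.tsum_comm]
          refine tsum_congr fun p => tsum_congr fun u => tsum_congr fun s => ?_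
          ring
  have hr : Strategy.comp σ (Strategy.comp τ υ) r =
      ∑' (q : Isog (A.hom B)) (p : Isog (B.hom C)) (u : Isog (C.hom D)),
        σ q * τ p * υ u * ∑' t, weight p.rep u.rep t * weight q.rep t.rep r := by
    simp only [comp_apply, ← ENNReal.tsum_mul_right, ← ENNReal.tsum_mul_left]
    refine tsum_congr fun q => ?_
    rw [ENNReal.tsum_comm]
    refine tsum_congr fun p => ?_
    rw [ENNReal.tsum_comm]
    refine tsum_congr fun u => tsum_congr fun t => ?_
    ring
  rw [hl, hr]
  simp only [weight_assoc hB hC]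

end Weight

/-! ### Unit laws for strategies -/

section Identity

variable {A B : Arena}

theorem Conf.finite_symmetry (x y : Conf A) : Finite (x.Symmetry y) := by
  have := x.isConf.finite
  have := y.isConf.finite
  refine Finite.of_injective (fun φ : x.Symmetry y => fun a => φ.1 a) fun φ ψ h => ?_
  exact Symmetry.ext (congrFun h)

theorem tsum_symmetry_one (x y : Conf A) :
    ∑' _ : x.Symmetry y, (1 : ENNReal) = Nat.card (x.Symmetry y) := by
  have := Conf.finite_symmetry x y
  have := Fintype.ofFinite (x.Symmetry y)
  rw [tsum_fintype, Finset.sum_const, Nat.card_eq_fintype_card, Finset.card_univ, nsmul_one]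

/-- The position of a configuration. -/
def Conf.position (x : Conf A) : Position A := Quotient.mk _ x

theorem Conf.nonempty_symmetry_rep (y : Conf A) : Nonempty (y.position.rep.Symmetry y) :=
  Quotient.mk_out y

theorem Conf.position_eq_of_symmetry {x : Position A} {y : Conf A} (θ : x.rep.Symmetry y) :
    x = y.position :=
  (Quotient.out_eq x).symm.trans (Quotient.sound ⟨θ⟩)

/-- Counting the symmetries between representatives of positions and a configuration. -/
theorem tsum_position_symmetry (y : Conf A) :
    ∑' x : Position A, (Nat.card (x.rep.Symmetry x.rep) : ENNReal)⁻¹ *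
      Nat.card (x.rep.Symmetry y) = 1 := by
  rw [tsum_eq_single y.position]
  · obtain ⟨θ⟩ := y.nonempty_symmetry_rep
    have := Conf.finite_symmetry y.position.rep y.position.rep
    have : Nonempty (y.position.rep.Symmetry y.position.rep) := ⟨.refl _⟩
    -- Composing with `θ` identifies the symmetries onto `y` with the endosymmetries of the
    -- representative, so the two factors cancel. No other position has a symmetry onto `y`.
    rw [Nat.card_congr (Conf.Symmetry.congr (Conf.Symmetry.refl y.position.rep) θ.symm)]
    exact ENNReal.inv_mul_cancel (by exact_mod_cast Nat.card_pos.ne') (ENNReal.natCast_ne_top _)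
  · intro x hx
    have : IsEmpty (x.rep.Symmetry y) := ⟨fun θ => hx (Conf.position_eq_of_symmetry θ)⟩
    simp

theorem tsum_id_mul (F : Isog (A.hom A) → ENNReal) :
    ∑' s, Strategy.id A s * F s = ∑' x : Position A,
      (Nat.card (x.rep.Symmetry x.rep) : ENNReal)⁻¹ * F (Aug.copycat x.rep).isog := by
  classical
  simp only [Strategy.id, ← ENNReal.tsum_mul_right]
  rw [ENNReal.tsum_comm]
  refine tsum_congr fun x => ?_
  have h : ∀ s : Isog (A.hom A), (PreAug.copycat x.rep).Isomorphic s.rep.toPreAug ↔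
      (Aug.copycat x.rep).isog = s := (Aug.copycat x.rep).isomorphic_rep_iff
  simp only [h]
  rw [tsum_eq_single (Aug.copycat x.rep).isog]
  · simp
  · intro s hs
    rw [if_neg hs.symm, zero_mul]

open Classical in
-- Every symmetry gives back the class of `p`, so the weight is the number of symmetries or zero.
theorem weight_copycat_left (x : Conf A) (p : Aug (A.hom B)) (r : Isog (A.hom B)) :
    weight (Aug.copycat x) p r =
      Nat.card (x.Symmetry p.deseq.left) * if p.isog = r then 1 else 0 := by
  have h : ∀ φ, (PreAug.comp (Aug.copycat x) p φ).Isomorphic r.rep.toPreAug ↔ p.isog = r := by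
    intro φ
    rw [← p.isomorphic_rep_iff]
    obtain ⟨e, e1, e2, e3⟩ := comp_copycat_left x p φ
    constructor
    · rintro ⟨f, f1, f2, f3⟩
      exact PreAug.isomorphic_of_common e f (fun a b => by rw [f1, e1])
        (fun a b => by rw [f2, e2]) (fun a => by rw [f3, e3])
    · rintro ⟨f, f1, f2, f3⟩
      exact ⟨e.trans f, fun a b => (f1 _ _).trans (e1 _ _), fun a b => (f2 _ _).trans (e2 _ _),
        fun a => (f3 _).trans (e3 _)⟩
  simp only [weight, h]
  rw [← tsum_symmetry_one, ← ENNReal.tsum_mul_right]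
  simp only [one_mul]
  exact ((Conf.Symmetry.congr (Conf.homRight x x) (Conf.Symmetry.refl p.deseq.left)).tsum_eq
    fun _ => if p.isog = r then 1 else 0).symm

open Classical in
theorem weight_copycat_right (x : Conf B) (q : Aug (A.hom B)) (r : Isog (A.hom B)) :
    weight q (Aug.copycat x) r =
      Nat.card (x.Symmetry q.deseq.right) * if q.isog = r then 1 else 0 := by
  have h : ∀ φ, (PreAug.comp q (Aug.copycat x) φ).Isomorphic r.rep.toPreAug ↔ q.isog = r := by
    intro φ
    rw [← q.isomorphic_rep_iff]
    obtain ⟨e, e1, e2, e3⟩ := comp_copycat_right x q φ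
    constructor
    · rintro ⟨f, f1, f2, f3⟩
      exact PreAug.isomorphic_of_common e f (fun a b => by rw [f1, e1])
        (fun a b => by rw [f2, e2]) (fun a => by rw [f3, e3])
    · rintro ⟨f, f1, f2, f3⟩
      exact ⟨e.trans f, fun a b => (f1 _ _).trans (e1 _ _), fun a b => (f2 _ _).trans (e2 _ _),
        fun a => (f3 _).trans (e3 _)⟩
  simp only [weight, h]
  rw [← tsum_symmetry_one, ← ENNReal.tsum_mul_right]
  simp only [one_mul]
  refine .trans ?_ ((Conf.Symmetry.inverse _ _).tsum_eq fun _ => if q.isog = r then 1 else 0)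
  exact ((Conf.Symmetry.congr (Conf.Symmetry.refl q.deseq.right) (Conf.homLeft x x)).tsum_eq
    fun _ => if q.isog = r then 1 else 0).symm

/-- For fixed `p`, summing over positions the number of symmetries onto the left part of `p`, each
divided by the number of endosymmetries, gives one; only `p = r` then survives. -/
theorem strategy_id_comp (hA : ∀ a, IsMinimal A.le a → A.pol a = .neg)
    (σ : Strategy (A.hom B)) : Strategy.comp (Strategy.id A) σ = σ := by
  classical
  funext r
  have key : ∀ p : Isog (A.hom B), ∑' s, Strategy.id A s * weight s.rep p.rep r =
      if p = r then 1 else 0 := by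
    intro p
    rw [tsum_id_mul]
    simp only [weight_congr hA (isomorphic_rep_isog _) (isomorphic_refl p.rep),
      weight_copycat_left, ← mul_assoc]
    rw [ENNReal.tsum_mul_right, tsum_position_symmetry, one_mul, p.isog_rep]
  rw [comp_apply, ENNReal.tsum_comm]
  calc _ = ∑' p : Isog (A.hom B), σ p * ∑' s, Strategy.id A s * weight s.rep p.rep r := by
        refine tsum_congr fun p => ?_
        rw [← ENNReal.tsum_mul_left]
        exact tsum_congr fun s => by ring
    _ = σ r := by
        simp only [key]
        rw [tsum_eq_single r fun p hp => by rw [if_neg hp, mul_zero], if_pos rfl, mul_one]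

theorem strategy_comp_id (hB : ∀ b, IsMinimal B.le b → B.pol b = .neg)
    (σ : Strategy (A.hom B)) : Strategy.comp σ (Strategy.id B) = σ := by
  classical
  funext r
  have key : ∀ q : Isog (A.hom B), ∑' s, Strategy.id B s * weight q.rep s.rep r =
      if q = r then 1 else 0 := by
    intro q
    rw [tsum_id_mul]
    simp only [weight_congr hB (isomorphic_refl q.rep) (isomorphic_rep_isog _),
      weight_copycat_right, ← mul_assoc]
    rw [ENNReal.tsum_mul_right, tsum_position_symmetry, one_mul, q.isog_rep]
  rw [comp_apply]
  calc _ = ∑' q : Isog (A.hom B), σ q * ∑' s, Strategy.id B s * weight q.rep s.rep r := by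
        refine tsum_congr fun q => ?_
        rw [← ENNReal.tsum_mul_left]
        exact tsum_congr fun s => by ring
    _ = σ r := by
        simp only [key]
        rw [tsum_eq_single r fun p hp => by rw [if_neg hp, mul_zero], if_pos rfl, mul_one]

end Identity

end ResourceGames

open ResourceGames in
theorem mainTheorem2 :
    -- copycats and compositions of augmentations are augmentations
    (∀ (A : NegArena) (x : Conf A.toArena), (PreAug.copycat x).IsAug) ∧
    (∀ (A B C : NegArena) (q : Aug (A.toArena.hom B.toArena)) (p : Aug (B.toArena.hom C.toArena))
      (φ : q.deseq.right.Symmetry p.deseq.left), (PreAug.comp q p φ).IsAug) ∧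
    -- the sum over mediating symmetries does not depend on the choice of representatives
    (∀ (A B C : NegArena) (q q' : Aug (A.toArena.hom B.toArena))
      (p p' : Aug (B.toArena.hom C.toArena)),
      q.toPreAug.Isomorphic q'.toPreAug → p.toPreAug.Isomorphic p'.toPreAug →
      ∃ χ : q.deseq.right.Symmetry p.deseq.left ≃ q'.deseq.right.Symmetry p'.deseq.left,
        ∀ φ, (PreAug.comp q p φ).Isomorphic (PreAug.comp q' p' (χ φ))) ∧
    -- the category laws hold
    ∃ 𝒞 : CategoryTheory.Category.{1, 1} NegArena, 𝒞.toCategoryStruct = stratStruct := by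
  refine ⟨fun A x => copycat_isAug x, fun A B C q p φ => comp_isAug B.negative φ,
    fun A B C q q' p p' hq hp => exists_symmetry_equiv hq hp,
    { toCategoryStruct := stratStruct
      id_comp := fun {A B} σ => strategy_id_comp A.negative σ
      comp_id := fun {A B} σ => strategy_comp_id B.negative σ
      assoc := fun {A B C D} σ τ υ => strategy_assoc B.negative C.negative σ τ υ }, rfl⟩
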